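/- Let $k$ be a field, let $a,b$ be coprime positive integers such that $\mathrm{char}(k)\nmid a$ and $\mathrm{char}(k)\nmid b$ (this always holds in characteristic $0$), and let $A=k[s^a,s^b]\subseteq k[s]$ and $A^e=A\otimes_k A^{op}$. Let $F_m$ be the free $A^e$-module with basis the elements $e_I t^{(q)}$, $I\subseteq\{1,2\}$, $q\ge 0$, $|I|+2q=m$, and let $d$ be the $A^e$-linear differential with $$d(e_1)=s^b\otimes 1-1\otimes s^b,\qquad d(e_2)=s^a\otimes 1-1\otimes s^a,$$ $$d(t)=\sum_{i=0}^{a-1}s^{ib}\otimes s^{b(a-1-i)}\, e_1-\sum_{i=0}^{b-1}s^{ia}\otimes s^{a(b-1-i)}\, e_2,$$ and $d(t^{(q)})=d(t)t^{(q-1)}$, $d(e_it^{(q)})=d(e_i)t^{(q)}-e_i\,d(t)\,t^{(q-1)}$, $d(e_1e_2t^{(q)})=(d(e_1)e_2-d(e_2)e_1)t^{(q)}$, where $t^{(0)}=1$ and $t^{(-1)}=0$. Then $F_\bullet$, with the augmentation $F_0=A^e\to A$, $u\otimes v\mapsto uv$, is a free resolution of the $A^e$-module $A$. The Hochschild cohomology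 $\mathrm{HH}^m(A)$ is the $m$-th cohomology of $\mathrm{Hom}_{A^e}(F_\bullet,A)$. The cochain $(e_It^{(q)},s^\alpha)$, which sends $e_It^{(q)}$ to $s^\alpha\in A$ and the other basis elements to $0$, is given the bidegree $\bigl(|I|+2q,\ \alpha-b[1\in I]-a[2\in I]-abq\bigr)$. Let $\mathbf H_{m,n}\subseteq \mathrm{HH}^m(A)$ be the space of classes of cocycles of bidegree $(m,n)$. Then $\mathrm{HH}^m(A)=\bigoplus_{n\in\mathbb Z}\mathbf H_{m,n}$ for every $m\ge 0$, each $\mathbf H_{m,n}$ is finite dimensional, and, in the ring $\mathbb Q((y))[[x]]$ of power series in $x$ whose coefficients are Laurent series in $y$, $$\sum_{m\ge 0,\ n\in\mathbb Z}\dim_k(\mathbf H_{m,n})\,x^my^n=\mathrm H_1+\mathrm H_2+\mathrm H_3 .$$ Here, with $m_1=b(a-1)$, $m_2=a(b-1)$ and $Q=\dfrac{x^2y^{-ab}}{1-x^2y^{-ab}}$, $$\mathrm H_1=\frac{1-y^{ab}}{(1-y^a)(1-y^b)},$$ $$\mathrm H_2=\mathrm H_{21}-(\mathrm H_{22}+\mathrm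 H_{23})+\mathrm H_{24},\qquad \mathrm H_{21}=Q\,\mathrm H_1,\quad \mathrm H_{22}=Q\,y^{m_1}\mathrm H_1,\quad \mathrm H_{23}=Q\,y^{m_2}\mathrm H_1,\quad \mathrm H_{24}=Q\,(y^{m_1+m_2}+y^{ab}\,\mathrm H_1),$$ $$\mathrm H_3=\mathrm H_{31}+\mathrm H_{32}-\mathrm H_{33},\qquad \mathrm H_{31}=x\,y^{ab-a-b}+x\,\mathrm H_1,\quad \mathrm H_{32}=x\,Q\,\mathrm H_1,\quad \mathrm H_{33}=x\,y^{ab-a-b}\,Q\,(\mathrm H_1-1).$$ -/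

import Mathlib

open scoped TensorProduct

namespace SemigroupHH

noncomputable section

/-! ## The algebra `A = k[s^a, s^b]` and its enveloping algebra -/

/-- The numerical semigroup algebra `k[s^a, s^b]`, as a subalgebra of `k[s]`. -/
def Alg (k : Type*) [Field k] (a b : ℕ) : Type _ :=
  ↥(Algebra.adjoin k ({Polynomial.X ^ a, Polynomial.X ^ b} : Set (Polynomial k)))

instance algCommRing (k : Type*) [Field k] (a b : ℕ) : CommRing (Alg k a b) :=
  inferInstanceAs
    (CommRing ↥(Algebra.adjoin k ({Polynomial.X ^ a, Polynomial.X ^ b} : Set (Polynomial k))))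

instance algAlgebra (k : Type*) [Field k] (a b : ℕ) : Algebra k (Alg k a b) :=
  inferInstanceAs
    (Algebra k ↥(Algebra.adjoin k ({Polynomial.X ^ a, Polynomial.X ^ b} : Set (Polynomial k))))

/-- The inclusion of `k[s^a, s^b]` into `k[s]`. -/
def toPoly (k : Type*) [Field k] (a b : ℕ) : Alg k a b →ₐ[k] Polynomial k :=
  (Algebra.adjoin k ({Polynomial.X ^ a, Polynomial.X ^ b} : Set (Polynomial k))).val

/-- The element `s^a` of `k[s^a, s^b]`. -/
def sa (k : Type*) [Field k] (a b : ℕ) : Alg k a b :=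
  ⟨Polynomial.X ^ a, Algebra.subset_adjoin (by simp)⟩

/-- The element `s^b` of `k[s^a, s^b]`. -/
def sb (k : Type*) [Field k] (a b : ℕ) : Alg k a b :=
  ⟨Polynomial.X ^ b, Algebra.subset_adjoin (by simp)⟩

/-- The enveloping algebra `A ⊗ A^op`. -/
def Env (k : Type*) [Field k] (a b : ℕ) : Type _ :=
  Alg k a b ⊗[k] (Alg k a b)ᵐᵒᵖ

instance envCommRing (k : Type*) [Field k] (a b : ℕ) : CommRing (Env k a b) :=
  inferInstanceAs (CommRing (Alg k a b ⊗[k] (Alg k a b)ᵐᵒᵖ))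

instance envAlgebra (k : Type*) [Field k] (a b : ℕ) : Algebra k (Env k a b) :=
  inferInstanceAs (Algebra k (Alg k a b ⊗[k] (Alg k a b)ᵐᵒᵖ))

/-- The element `u ⊗ v` of `A ⊗ A^op`. -/
def tm {k : Type*} [Field k] {a b : ℕ} (u v : Alg k a b) : Env k a b :=
  u ⊗ₜ[k] MulOpposite.op v

/-- `A` as an `A ⊗ A^op`-module: `(u ⊗ v) • m = u m v`. -/
instance envModule (k : Type*) [Field k] (a b : ℕ) : Module (Env k a b) (Alg k a b) :=
  TensorProduct.Algebra.module

theorem tm_smul {k : Type*} [Field k] {a b : ℕ} (u v m : Alg k a b) :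
    tm u v • m = u * m * v :=
  (mul_assoc u m v).symm

instance envTower (k : Type*) [Field k] (a b : ℕ) :
    IsScalarTower k (Env k a b) (Alg k a b) where
  smul_assoc c x m :=
    LinearMap.congr_fun
      (map_smul (TensorProduct.Algebra.moduleAux (R := k) (A := Alg k a b)
        (B := (Alg k a b)ᵐᵒᵖ) (M := Alg k a b)) c x) m

/-! ## The resolution `F` -/

/-- The basis elements `1, e₁, e₂, e₁ ∧ e₂` of the exterior algebra. -/
inductive Wedge : Type
  | one
  | e₁
  | e₂
  | e₁₂

/-- The exterior degree. -/
def Wedge.deg : Wedge → ℕ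
  | .one => 0
  | .e₁ => 1
  | .e₂ => 1
  | .e₁₂ => 2

/-- The pair `(I, q)` stands for the basis element `e_I t^{(q)}`. -/
abbrev Gen : Type := Wedge × ℕ

/-- The homological degree of `e_I t^{(q)}`, namely `|I| + 2 q`. -/
def Gen.deg (g : Gen) : ℕ := g.1.deg + 2 * g.2

/-- The basis elements of homological degree `m`. -/
abbrev GenDeg (m : ℕ) : Type := {g : Gen // g.deg = m}

/-- `d(e₁) = s^b ⊗ 1 - 1 ⊗ s^b`. -/
def dE₁ (k : Type*) [Field k] (a b : ℕ) : Env k a b :=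
  tm (sb k a b) 1 - tm 1 (sb k a b)

/-- `d(e₂) = s^a ⊗ 1 - 1 ⊗ s^a`. -/
def dE₂ (k : Type*) [Field k] (a b : ℕ) : Env k a b :=
  tm (sa k a b) 1 - tm 1 (sa k a b)

/-- The coefficient of `e₁` in `d(t)`: `∑_{i=0}^{a-1} s^{ib} ⊗ s^{b(a-1-i)}`. -/
def dT₁ (k : Type*) [Field k] (a b : ℕ) : Env k a b :=
  ∑ i ∈ Finset.range a, tm (sb k a b ^ i) (sb k a b ^ (a - 1 - i))

/-- Minus the coefficient of `e₂` in `d(t)`: `∑_{i=0}^{b-1} s^{ia} ⊗ s^{a(b-1-i)}`. -/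
def dT₂ (k : Type*) [Field k] (a b : ℕ) : Env k a b :=
  ∑ i ∈ Finset.range b, tm (sa k a b ^ i) (sa k a b ^ (b - 1 - i))

/-- The differential on basis elements. With `d(t) = dT₁ e₁ - dT₂ e₂`:
`d(t^{(q)}) = d(t) t^{(q-1)}`, `d(e_i t^{(q)}) = d(e_i) t^{(q)} - e_i d(t) t^{(q-1)}`,
`d(e₁ e₂ t^{(q)}) = (d(e₁) e₂ - d(e₂) e₁) t^{(q)}`, where `t^{(-1)} = 0`. -/
def dGen (k : Type*) [Field k] (a b : ℕ) : Gen → (Gen →₀ Env k a b)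
  | (.one, 0) => 0
  | (.one, q + 1) =>
      Finsupp.single (.e₁, q) (dT₁ k a b) - Finsupp.single (.e₂, q) (dT₂ k a b)
  | (.e₁, 0) => Finsupp.single (.one, 0) (dE₁ k a b)
  | (.e₁, q + 1) =>
      Finsupp.single (.one, q + 1) (dE₁ k a b) + Finsupp.single (.e₁₂, q) (dT₂ k a b)
  | (.e₂, 0) => Finsupp.single (.one, 0) (dE₂ k a b)
  | (.e₂, q + 1) =>
      Finsupp.single (.one, q + 1) (dE₂ k a b) + Finsupp.single (.e₁₂, q) (dT₁ k a b)
  | (.e₁₂, q) =>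
      Finsupp.single (.e₂, q) (dE₁ k a b) - Finsupp.single (.e₁, q) (dE₂ k a b)

/-- The differential lowers the homological degree by one. -/
theorem dGen_deg (k : Type*) [Field k] (a b : ℕ) (g g' : Gen)
    (h : dGen k a b g g' ≠ 0) : g'.deg + 1 = g.deg := by
  classical
  by_contra hne
  apply h
  obtain ⟨w, q⟩ := g
  obtain ⟨w', q'⟩ := g'
  cases w <;> cases q <;> cases w' <;>
    simp [dGen, Finsupp.single_apply, Gen.deg, Wedge.deg] at hne ⊢ <;> grind

/-- `F_m`, the free `A ⊗ A^op`-module on the `e_I t^{(q)}` with `|I| + 2 q = m`. -/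
abbrev F (k : Type*) [Field k] (a b : ℕ) (m : ℕ) : Type _ := GenDeg m →₀ Env k a b

/-- The differential `F_{m+1} → F_m`. All basis elements that occur in `dGen g` have degree `m`
if `g` has degree `m + 1`, so that the restriction to the basis elements of degree `m`
loses nothing. -/
def d (k : Type*) [Field k] (a b : ℕ) (m : ℕ) : F k a b (m + 1) →ₗ[Env k a b] F k a b m :=
  Finsupp.linearCombination (Env k a b)
    (fun g : GenDeg (m + 1) => (dGen k a b g.1).subtypeDomain (fun g' : Gen => g'.deg = m))

/-- The augmentation `ε : F_0 → A`; it sends the basis element `1 = t^{(0)}` to `1`, so that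
`x ⊗ y` goes to `x y`. -/
def augmentation (k : Type*) [Field k] (a b : ℕ) : F k a b 0 →ₗ[Env k a b] Alg k a b :=
  Finsupp.linearCombination (Env k a b) (fun _ : GenDeg 0 => (1 : Alg k a b))

/-! ## Hochschild cohomology and its bigrading -/

/-- `Hom_{A ⊗ A^op}(F_m, A)`. -/
def Cochain (k : Type*) [Field k] (a b : ℕ) (m : ℕ) : Type _ :=
  F k a b m →ₗ[Env k a b] Alg k a b

instance cochainAddCommGroup (k : Type*) [Field k] (a b : ℕ) (m : ℕ) :
    AddCommGroup (Cochain k a b m) :=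
  inferInstanceAs (AddCommGroup (F k a b m →ₗ[Env k a b] Alg k a b))

instance cochainModule (k : Type*) [Field k] (a b : ℕ) (m : ℕ) :
    Module k (Cochain k a b m) :=
  inferInstanceAs (Module k (F k a b m →ₗ[Env k a b] Alg k a b))

/-- The value of a cochain at a basis element of `F_m`. -/
def Cochain.value {k : Type*} [Field k] {a b m : ℕ} (f : Cochain k a b m) (g : GenDeg m) :
    Alg k a b :=
  (show F k a b m →ₗ[Env k a b] Alg k a b from f) (Finsupp.single g 1)

/-- The coboundary `Hom(F_m, A) → Hom(F_{m+1}, A)`, `f ↦ f ∘ d`. -/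
def coboundary (k : Type*) [Field k] (a b : ℕ) (m : ℕ) :
    Cochain k a b m →ₗ[k] Cochain k a b (m + 1) :=
  LinearMap.lcomp k (Alg k a b) (d k a b m)

/-- The cocycles of degree `m`. -/
abbrev cocycles (k : Type*) [Field k] (a b : ℕ) (m : ℕ) : Submodule k (Cochain k a b m) :=
  LinearMap.ker (coboundary k a b m)

/-- The coboundaries of degree `m`. -/
def coboundaries (k : Type*) [Field k] (a b : ℕ) : (m : ℕ) → Submodule k (Cochain k a b m)
  | 0 => ⊥
  | m + 1 => LinearMap.range (coboundary k a b m)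

/-- The Hochschild cohomology `HH^m(A)`: cocycles modulo coboundaries. -/
abbrev HH (k : Type*) [Field k] (a b : ℕ) (m : ℕ) : Type _ :=
  ↥(cocycles k a b m) ⧸ (coboundaries k a b m).submoduleOf (cocycles k a b m)

/-- The homogeneous component of `A` of degree `j`, spanned by `s^j` if `s^j` lies in `A`,
and zero otherwise. -/
def algPiece (k : Type*) [Field k] (a b : ℕ) (j : ℤ) : Submodule k (Alg k a b) :=
  Submodule.span k {u | ∃ α : ℕ, (α : ℤ) = j ∧ toPoly k a b u = Polynomial.X ^ α}

/-- The weight of a generator in the resolution: `e₁`, `e₂`, `t` have weights `b`, `a`, `a b`. -/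
def Gen.weight (a b : ℕ) : Gen → ℤ
  | (.one, q) => (a * b : ℤ) * q
  | (.e₁, q) => b + (a * b : ℤ) * q
  | (.e₂, q) => a + (a * b : ℤ) * q
  | (.e₁₂, q) => a + b + (a * b : ℤ) * q

/-- The cochains of weight `n`, where the cochain `(e_I t^{(q)}, s^α)`, which sends
`e_I t^{(q)}` to `s^α` and the other basis elements to zero, has weight
`α - weight (e_I t^{(q)})`. -/
def cochainPiece (k : Type*) [Field k] (a b : ℕ) (m : ℕ) (n : ℤ) :
    Submodule k (Cochain k a b m) where
  carrier := {f | ∀ g : GenDeg m,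
    f.value g ∈ algPiece k a b (n + g.1.weight a b)}
  add_mem' hf hf' g := Submodule.add_mem _ (hf g) (hf' g)
  zero_mem' _ := Submodule.zero_mem _
  smul_mem' c _ hf g := Submodule.smul_mem _ c (hf g)

/-- The component `H_{m,n}` of `HH^m(A)`: the classes of the cocycles of weight `n`. -/
def HHPiece (k : Type*) [Field k] (a b : ℕ) (m : ℕ) (n : ℤ) : Submodule k (HH k a b m) :=
  ((cochainPiece k a b m n).submoduleOf (cocycles k a b m)).map
    ((coboundaries k a b m).submoduleOf (cocycles k a b m)).mkQ

/-! ## Hilbert series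

The series live in `ℚ((y))[[x]]`: power series in `x` over the field of Laurent series in `y`. -/

/-- Formal series in `x` and `y`. -/
abbrev Series : Type := PowerSeries (LaurentSeries ℚ)

/-- `P` is the Hilbert series `∑ dim_k(H_{m,n}) x^m y^n` of the Hochschild cohomology of
`k[s^a, s^b]`; in particular all the dimensions are finite. -/
def IsHilbertSeries (k : Type*) [Field k] (a b : ℕ) (P : Series) : Prop :=
  ∀ (m : ℕ) (n : ℤ), Module.Finite k (HHPiece k a b m n) ∧
    (PowerSeries.coeff m P).coeff n = (Module.finrank k (HHPiece k a b m n) : ℚ)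

/-- The variable `x`. -/
def x : Series := PowerSeries.X

/-- The monomial `y^n`, for an integer `n`. -/
def y (n : ℤ) : Series := PowerSeries.C (HahnSeries.single n (1 : ℚ))

/-- `m₁ = b (a - 1)`. -/
def m₁ (a b : ℕ) : ℤ := b * (a - 1)

/-- `m₂ = a (b - 1)`. -/
def m₂ (a b : ℕ) : ℤ := a * (b - 1)

/-- `x² y^{-ab} / (1 - x² y^{-ab})`. -/
def Q (a b : ℕ) : Series := x ^ 2 * y (-(a * b)) * (1 - x ^ 2 * y (-(a * b)))⁻¹

/-- `(1 - y^{ab}) / ((1 - y^a)(1 - y^b))`. -/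
def H₁ (a b : ℕ) : Series := (1 - y (a * b)) * ((1 - y a) * (1 - y b))⁻¹

/-- The denominators in `Q` and `H₁` are invertible series. -/
theorem denominators_ne_zero (a b : ℕ) (ha : 0 < a) (hb : 0 < b) :
    PowerSeries.constantCoeff (1 - x ^ 2 * y (-(a * b))) ≠ 0 ∧
      PowerSeries.constantCoeff ((1 - y a) * (1 - y b)) ≠ 0 := by
  have h : ∀ c : ℕ, 0 < c → (1 : LaurentSeries ℚ) - HahnSeries.single (c : ℤ) (1 : ℚ) ≠ 0 := by
    intro c hc h0
    have := congrArg (fun f : LaurentSeries ℚ => f.coeff 0) h0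
    simp [HahnSeries.coeff_single_of_ne (show (0 : ℤ) ≠ (c : ℤ) by omega)] at this
  refine ⟨by simp [x], ?_⟩
  simpa [y] using ⟨h a ha, h b hb⟩

def H₂₁ (a b : ℕ) : Series := Q a b * H₁ a b

def H₂₂ (a b : ℕ) : Series := Q a b * y (m₁ a b) * H₁ a b

def H₂₃ (a b : ℕ) : Series := Q a b * y (m₂ a b) * H₁ a b

def H₂₄ (a b : ℕ) : Series := Q a b * (y (m₁ a b + m₂ a b) + y (a * b) * H₁ a b)

def H₂ (a b : ℕ) : Series := H₂₁ a b - (H₂₂ a b + H₂₃ a b) + H₂₄ a b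

def H₃₁ (a b : ℕ) : Series := x * y (a * b - a - b) + x * H₁ a b

def H₃₂ (a b : ℕ) : Series := x * Q a b * H₁ a b

def H₃₃ (a b : ℕ) : Series := x * y (a * b - a - b) * Q a b * (H₁ a b - 1)

def H₃ (a b : ℕ) : Series := H₃₁ a b + H₃₂ a b - H₃₃ a b

end

end SemigroupHH

namespace SemigroupHH

/-! ## Numerical semigroups generated by two elements -/

/-- `n` lies in the numerical semigroup generated by `a` and `b`. -/
def InSemigroup (a b : ℕ) (n : ℤ) : Prop := ∃ i j : ℕ, n = a * i + b * j

namespace InSemigroup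

variable {a b : ℕ}

theorem zero (a b : ℕ) : InSemigroup a b 0 := ⟨0, 0, by simp⟩

theorem add {m n : ℤ} (hm : InSemigroup a b m) (hn : InSemigroup a b n) :
    InSemigroup a b (m + n) := by
  obtain ⟨i, j, rfl⟩ := hm
  obtain ⟨i', j', rfl⟩ := hn
  exact ⟨i + i', j + j', by push_cast; ring⟩

theorem nonneg {n : ℤ} (hn : InSemigroup a b n) : 0 ≤ n := by
  obtain ⟨i, j, rfl⟩ := hn
  positivity

theorem exists_lt (ha : 0 < a) {n : ℤ} (hn : InSemigroup a b n) :
    ∃ i j : ℕ, j < a ∧ n = a * i + b * j := by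
  obtain ⟨i, j, rfl⟩ := hn
  refine ⟨i + b * (j / a), j % a, Nat.mod_lt _ ha, ?_⟩
  have := Nat.div_add_mod j a
  have h : (j : ℤ) = a * (j / a : ℕ) + (j % a : ℕ) := by exact_mod_cast this.symm
  generalize j / a = q at *
  generalize j % a = r at *
  rw [h]
  push_cast
  ring

theorem iff_nonneg (ha : 0 < a) (hab : Nat.Coprime a b) {z : ℤ} {j : ℕ} (hj : j < a) :
    InSemigroup a b (a * z + b * j) ↔ 0 ≤ z := by
  constructor
  · intro h
    obtain ⟨i, j', hj', h⟩ := h.exists_lt ha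
    have hdvd : (a : ℤ) ∣ (j' : ℤ) - j := by
      have hc : IsCoprime (a : ℤ) (b : ℤ) := Nat.isCoprime_iff_coprime.mpr hab
      apply hc.dvd_of_dvd_mul_left
      exact ⟨z - i, by linear_combination -h⟩
    have hjj : (j' : ℤ) - j = 0 :=
      Int.eq_zero_of_abs_lt_dvd hdvd (by rw [abs_lt]; constructor <;> omega)
    have hz : (a : ℤ) * z = a * i := by linear_combination h + b * hjj
    have := mul_left_cancel₀ (by exact_mod_cast ha.ne') hz
    omega
  · intro h
    lift z to ℕ using h
    exact ⟨z, j, rfl⟩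

theorem not_frobenius (ha : 0 < a) (hab : Nat.Coprime a b) :
    ¬ InSemigroup a b (a * b - a - b) := by
  have := iff_nonneg (z := -1) ha hab (Nat.sub_lt ha one_pos)
  rw [show (a * b - a - b : ℤ) = a * (-1) + b * (a - 1 : ℕ) by
    rw [Nat.cast_sub (show 1 ≤ a from ha)]; push_cast; ring, this]
  norm_num

/-- The elements of the semigroup outside its translate by `a`. -/
theorem and_not_sub_iff (ha : 0 < a) (hab : Nat.Coprime a b) {n : ℤ} :
    (InSemigroup a b n ∧ ¬ InSemigroup a b (n - a)) ↔ ∃ j : ℕ, j < a ∧ n = b * j := by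
  constructor
  · rintro ⟨h, h'⟩
    obtain ⟨i, j, hj, rfl⟩ := h.exists_lt ha
    rw [show (a * i + b * j - a : ℤ) = a * (i - 1) + b * j by ring, iff_nonneg ha hab hj] at h'
    obtain rfl : i = 0 := by omega
    exact ⟨j, hj, by simp⟩
  · rintro ⟨j, hj, rfl⟩
    refine ⟨⟨0, j, by simp⟩, ?_⟩
    rw [show (b * j - a : ℤ) = a * (-1) + b * j by ring, iff_nonneg ha hab hj]
    norm_num

theorem m₁_mem (ha : 0 < a) : InSemigroup a b (m₁ a b) :=
  ⟨0, a - 1, by rw [Nat.cast_sub (show 1 ≤ a from ha), m₁]; push_cast; ring⟩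

theorem m₂_mem (hb : 0 < b) : InSemigroup a b (m₂ a b) :=
  ⟨b - 1, 0, by rw [Nat.cast_sub (show 1 ≤ b from hb), m₂]; push_cast; ring⟩

theorem left_mem : InSemigroup a b a := ⟨1, 0, by simp⟩

theorem right_mem : InSemigroup a b b := ⟨0, 1, by simp⟩

/-- The intersection of the ideals generated by `m₁` and `m₂`. -/
theorem inter_iff (ha : 0 < a) (hb : 0 < b) (hab : Nat.Coprime a b) {n : ℤ} :
    (InSemigroup a b (n - m₁ a b) ∧ InSemigroup a b (n - m₂ a b)) ↔
      n = m₁ a b + m₂ a b ∨ InSemigroup a b (n - a * b) := by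
  constructor
  · rintro ⟨h₁, h₂⟩
    obtain ⟨i, j, hj, h⟩ := h₁.exists_lt ha
    obtain rfl : n = b * (a - 1) + (a * i + b * j) := by rw [← h, m₁]; ring
    obtain _ | j := j
    · rw [show (b * (a - 1) + (a * i + b * (0 : ℕ)) - m₂ a b : ℤ)
          = a * (i + 1 - b) + b * (a - 1 : ℕ) by
        rw [Nat.cast_sub (show 1 ≤ a from ha), m₂]; push_cast; ring,
        iff_nonneg ha hab (Nat.sub_lt ha one_pos)] at h₂
      obtain h | h : (i : ℤ) = b - 1 ∨ 0 ≤ (i : ℤ) - b := by omega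
      · left
        rw [h, m₁, m₂]
        push_cast
        ring
      · right
        obtain ⟨c, hc⟩ := Int.eq_ofNat_of_zero_le h
        refine ⟨c, a - 1, ?_⟩
        rw [Nat.cast_sub (show 1 ≤ a from ha)]
        push_cast
        linear_combination (a : ℤ) * hc
    · exact Or.inr ⟨i, j, by push_cast; ring⟩
  · rintro (rfl | h)
    · simpa using ⟨m₂_mem hb, m₁_mem ha⟩
    · refine ⟨?_, ?_⟩
      · convert h.add right_mem using 1
        rw [m₁]; ring
      · convert h.add left_mem using 1
        rw [m₂]; ring

end InSemigroup

/-! ## The enveloping algebra -/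

noncomputable section

open Polynomial

section

variable {k : Type*} [Field k] {a b : ℕ}

theorem toPoly_injective : Function.Injective (toPoly k a b) := Subtype.val_injective

@[simp] theorem toPoly_sa : toPoly k a b (sa k a b) = X ^ a := rfl

@[simp] theorem toPoly_sb : toPoly k a b (sb k a b) = X ^ b := rfl

instance : IsDomain (Alg k a b) := toPoly_injective.isDomain (toPoly k a b).toRingHom

theorem sb_pow_a : sb k a b ^ a = sa k a b ^ b :=
  toPoly_injective (by simp only [map_pow, toPoly_sa, toPoly_sb, ← pow_mul, mul_comm])

theorem Alg.induction {p : Alg k a b → Prop} (algebraMap : ∀ c, p (algebraMap k _ c))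
    (sa : p (sa k a b)) (sb : p (sb k a b)) (add : ∀ u v, p u → p v → p (u + v))
    (mul : ∀ u v, p u → p v → p (u * v)) (u : Alg k a b) : p u := by
  obtain ⟨u, hu⟩ := u
  induction hu using Algebra.adjoin_induction with
  | mem x hx =>
    rcases hx with rfl | rfl
    · exact sa
    · exact sb
  | algebraMap c => exact algebraMap c
  | add x y hx hy ihx ihy => exact add _ _ ihx ihy
  | mul x y hx hy ihx ihy => exact mul _ _ ihx ihy

theorem tm_mul_tm (u v u' v' : Alg k a b) : tm u v * tm u' v' = tm (u * u') (v * v') := by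
  rw [mul_comm v v']
  exact Algebra.TensorProduct.tmul_mul_tmul u u' (MulOpposite.op v) (MulOpposite.op v')

theorem Env.induction {p : Env k a b → Prop} (zero : p 0) (tm : ∀ u v, p (tm u v))
    (add : ∀ x y, p x → p y → p (x + y)) (x : Env k a b) : p x :=
  TensorProduct.induction_on x zero (fun u v => tm u v.unop) add

variable (k a b) in
/-- The algebra map `u ↦ u ⊗ 1`. -/
def inLeft : Alg k a b →ₐ[k] Env k a b :=
  (Algebra.TensorProduct.includeLeft : Alg k a b →ₐ[k] Alg k a b ⊗[k] (Alg k a b)ᵐᵒᵖ)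

variable (k a b) in
/-- The algebra map `v ↦ 1 ⊗ v`. -/
def inRight : Alg k a b →ₐ[k] Env k a b :=
  (Algebra.TensorProduct.includeRight : (Alg k a b)ᵐᵒᵖ →ₐ[k] Alg k a b ⊗[k] (Alg k a b)ᵐᵒᵖ).comp
    (AlgEquiv.toOpposite k (Alg k a b)).toAlgHom

theorem inLeft_apply (u : Alg k a b) : inLeft k a b u = tm u 1 := rfl

theorem inRight_apply (u : Alg k a b) : inRight k a b u = tm 1 u := rfl

theorem tm_eq (u v : Alg k a b) : tm u v = inLeft k a b u * inRight k a b v := by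
  rw [inLeft_apply, inRight_apply, tm_mul_tm, one_mul, mul_one]

/-- The algebra map `u ⊗ v ↦ f u * g v`. -/
def Env.lift {C : Type*} [CommRing C] [Algebra k C] (f g : Alg k a b →ₐ[k] C) :
    Env k a b →ₐ[k] C :=
  (Algebra.TensorProduct.productMap f
    (g.comp (AlgEquiv.toOpposite k (Alg k a b)).symm.toAlgHom) :
      Alg k a b ⊗[k] (Alg k a b)ᵐᵒᵖ →ₐ[k] C)

@[simp] theorem Env.lift_tm {C : Type*} [CommRing C] [Algebra k C] (f g : Alg k a b →ₐ[k] C)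
    (u v : Alg k a b) : Env.lift f g (tm u v) = f u * g v :=
  Algebra.TensorProduct.productMap_apply_tmul _ _ _ _

variable (k a b) in
/-- The multiplication map `u ⊗ v ↦ u * v`. -/
def mulMap : Env k a b →ₐ[k] Alg k a b := Env.lift (AlgHom.id k _) (AlgHom.id k _)

@[simp] theorem mulMap_tm (u v : Alg k a b) : mulMap k a b (tm u v) = u * v := by
  simp [mulMap]

theorem smul_eq_mulMap_mul (x : Env k a b) (m : Alg k a b) : x • m = mulMap k a b x * m := by
  induction x using Env.induction with
  | zero => simp
  | tm u v => rw [tm_smul, mulMap_tm]; ring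
  | add x y hx hy => rw [add_smul, hx, hy, map_add, add_mul]

variable (k a b) in
/-- The embedding of `A ⊗ A` into the polynomial ring in two variables. -/
def toPolyPoly : Env k a b →ₐ[k] k[X][X] :=
  Env.lift (CAlgHom.comp (toPoly k a b))
    ((mapAlgHom (Algebra.ofId k k[X])).comp (toPoly k a b))

theorem toPolyPoly_injective : Function.Injective (toPolyPoly k a b) := by
  have h₁ := TensorProduct.map_injective_of_flat_flat (toPoly k a b).toLinearMap
    ((toPoly k a b).comp (AlgEquiv.toOpposite k (Alg k a b)).symm.toAlgHom).toLinearMap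
    toPoly_injective (toPoly_injective.comp (AlgEquiv.injective _))
  let ψ : Env k a b →ₗ[k] k[X][X] :=
    ((polyEquivTensor k k[X]).symm.toLinearEquiv.toLinearMap.comp
      (TensorProduct.map (toPoly k a b).toLinearMap
        ((toPoly k a b).comp (AlgEquiv.toOpposite k (Alg k a b)).symm.toAlgHom).toLinearMap) :)
  have hψ : Function.Injective ψ := (polyEquivTensor k k[X]).symm.injective.comp h₁
  have h : ∀ x, toPolyPoly k a b x = ψ x := by
    intro x
    induction x using Env.induction with
    | zero => rw [map_zero, map_zero]
    | add x y hx hy => rw [map_add, hx, hy, map_add]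
    | tm u v =>
      rw [toPolyPoly, Env.lift_tm]
      change _ = (polyEquivTensor k k[X]).symm (toPoly k a b u ⊗ₜ toPoly k a b v)
      rw [polyEquivTensor_symm_apply_tmul_eq_smul, smul_eq_C_mul]
      rfl
  rw [show ⇑(toPolyPoly k a b) = ψ from funext h]
  exact hψ

instance : IsDomain (Env k a b) := toPolyPoly_injective.isDomain (toPolyPoly k a b).toRingHom

theorem dE₂_ne_zero (ha : 0 < a) : dE₂ k a b ≠ 0 := by
  intro h
  have := congrArg (toPolyPoly k a b) h
  simp only [dE₂, toPolyPoly, map_sub, Env.lift_tm, map_one, mul_one, one_mul, map_zero] at this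
  have := congrArg (fun p => p.coeff a) this
  simp [mapAlgHom] at this
  rw [← C_pow, coeff_C, if_neg ha.ne'] at this
  simp at this

theorem dE₁_mul_dT₁ : dE₁ k a b * dT₁ k a b = tm (sb k a b ^ a) 1 - tm 1 (sb k a b ^ a) := by
  simp only [dE₁, dT₁, tm_eq, map_pow, map_one, mul_one, one_mul]
  rw [mul_comm, Commute.geom_sum₂_mul (Commute.all _ _)]

theorem dE₂_mul_dT₂ : dE₂ k a b * dT₂ k a b = tm (sa k a b ^ b) 1 - tm 1 (sa k a b ^ b) := by
  simp only [dE₂, dT₂, tm_eq, map_pow, map_one, mul_one, one_mul]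
  rw [mul_comm, Commute.geom_sum₂_mul (Commute.all _ _)]

theorem dE₁_mul_dT₁_eq : dE₁ k a b * dT₁ k a b = dE₂ k a b * dT₂ k a b := by
  rw [dE₁_mul_dT₁, dE₂_mul_dT₂, sb_pow_a]

/-! ### Reduction modulo `s^a ⊗ 1 - 1 ⊗ s^a` -/

variable (k a b) in
/-- The map `A[T] → A ⊗ A` that sends `T` to `1 ⊗ s^b`. -/
def polyToEnv : (Alg k a b)[X] →+* Env k a b :=
  eval₂RingHom (inLeft k a b).toRingHom (inRight k a b (sb k a b))

@[simp] theorem polyToEnv_C (u : Alg k a b) : polyToEnv k a b (C u) = inLeft k a b u := by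
  simp [polyToEnv]

@[simp] theorem polyToEnv_X : polyToEnv k a b X = inRight k a b (sb k a b) := by
  simp [polyToEnv]

/-- Modulo `s^a ⊗ 1 - 1 ⊗ s^a`, every element of `A ⊗ A` is a polynomial in `1 ⊗ s^b`. -/
theorem exists_eq_polyToEnv_add (x : Env k a b) :
    ∃ h w, x = polyToEnv k a b h + dE₂ k a b * w := by
  have hmul : ∀ x y : Env k a b, (∃ h w, x = polyToEnv k a b h + dE₂ k a b * w) →
      (∃ h w, y = polyToEnv k a b h + dE₂ k a b * w) →
      ∃ h w, x * y = polyToEnv k a b h + dE₂ k a b * w := by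
    rintro _ _ ⟨h, w, rfl⟩ ⟨h', w', rfl⟩
    refine ⟨h * h', polyToEnv k a b h * w' + w * polyToEnv k a b h' + dE₂ k a b * w * w', ?_⟩
    rw [map_mul]; ring
  have hadd : ∀ x y : Env k a b, (∃ h w, x = polyToEnv k a b h + dE₂ k a b * w) →
      (∃ h w, y = polyToEnv k a b h + dE₂ k a b * w) →
      ∃ h w, x + y = polyToEnv k a b h + dE₂ k a b * w := by
    rintro _ _ ⟨h, w, rfl⟩ ⟨h', w', rfl⟩
    exact ⟨h + h', w + w', by rw [map_add]; ring⟩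
  induction x using Env.induction with
  | zero => exact ⟨0, 0, by simp⟩
  | add x y hx hy => exact hadd x y hx hy
  | tm u v =>
    rw [tm_eq]
    refine hmul _ _ ⟨C u, 0, by simp⟩ ?_
    induction v using Alg.induction with
    | algebraMap c =>
      refine ⟨C (algebraMap k _ c), 0, ?_⟩
      rw [polyToEnv_C, AlgHom.commutes, AlgHom.commutes, mul_zero, add_zero]
    | sa => exact ⟨C (sa k a b), -1, by rw [polyToEnv_C, inLeft_apply, inRight_apply, dE₂]; ring⟩
    | sb => exact ⟨X, 0, by simp⟩
    | add u v hu hv => rw [map_add]; exact hadd _ _ hu hv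
    | mul u v hu hv => rw [map_mul]; exact hmul _ _ hu hv

variable (k a b) in
/-- The map `A ⊗ A → k[s][ℤ/a]` with `u ⊗ s^n ↦ u s^n [n]`. -/
def toGroupAlg : Env k a b →ₐ[k] AddMonoidAlgebra k[X] (ZMod a) :=
  Env.lift ((AddMonoidAlgebra.singleZeroAlgHom :
      k[X] →ₐ[k] AddMonoidAlgebra k[X] (ZMod a)).comp (toPoly k a b))
    ((aeval (AddMonoidAlgebra.single (1 : ZMod a) (X : k[X]))).comp (toPoly k a b))

theorem toGroupAlg_inLeft (u : Alg k a b) :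
    toGroupAlg k a b (inLeft k a b u) = AddMonoidAlgebra.single 0 (toPoly k a b u) := by
  rw [inLeft_apply, toGroupAlg, Env.lift_tm, map_one, mul_one]
  rfl

theorem toGroupAlg_inRight_sb :
    toGroupAlg k a b (inRight k a b (sb k a b)) =
      AddMonoidAlgebra.single (b : ZMod a) (X ^ b) := by
  rw [inRight_apply, toGroupAlg, Env.lift_tm, map_one, one_mul]
  simp [AddMonoidAlgebra.single_pow]

theorem toGroupAlg_dE₂ : toGroupAlg k a b (dE₂ k a b) = 0 := by
  have h : toGroupAlg k a b (inRight k a b (sa k a b)) =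
      AddMonoidAlgebra.single 0 (X ^ a) := by
    rw [inRight_apply, toGroupAlg, Env.lift_tm, map_one, one_mul]
    simp [AddMonoidAlgebra.single_pow]
  rw [dE₂, ← inLeft_apply, ← inRight_apply, map_sub, h, toGroupAlg_inLeft, toPoly_sa, sub_self]

theorem toGroupAlg_polyToEnv (h : (Alg k a b)[X]) :
    toGroupAlg k a b (polyToEnv k a b h) = h.sum fun i u =>
      AddMonoidAlgebra.single ((b * i : ℕ) : ZMod a) (toPoly k a b u * X ^ (b * i)) := by
  rw [polyToEnv, coe_eval₂RingHom, eval₂_eq_sum, Polynomial.sum, map_sum, Polynomial.sum]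
  refine Finset.sum_congr rfl fun i _ => ?_
  rw [map_mul, map_pow, toGroupAlg_inRight_sb]
  change toGroupAlg k a b (inLeft k a b _) * _ = _
  rw [toGroupAlg_inLeft, AddMonoidAlgebra.single_pow, AddMonoidAlgebra.single_mul_single]
  simp [← pow_mul, mul_comm]

theorem eq_zero_of_toGroupAlg_polyToEnv (hab : Nat.Coprime a b) {h : (Alg k a b)[X]}
    (hdeg : h.natDegree < a) (h0 : toGroupAlg k a b (polyToEnv k a b h) = 0) : h = 0 := by
  classical
  ext1 i
  rw [coeff_zero]
  by_cases hi : i < a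
  swap
  · exact coeff_eq_zero_of_natDegree_lt (by omega)
  rw [toGroupAlg_polyToEnv, sum_over_range' _ (by simp) a hdeg] at h0
  have := congrArg (fun f => f.coeff ((b * i : ℕ) : ZMod a)) h0
  simp only [AddMonoidAlgebra.coeff_sum, AddMonoidAlgebra.coeff_zero, Finsupp.finsetSum_apply,
    AddMonoidAlgebra.coeff_single, Finsupp.single_apply] at this
  rw [Finset.sum_eq_single i] at this
  · exact toPoly_injective (by simpa using this)
  · intro j hj hji
    rw [if_neg]
    intro hij
    rw [ZMod.natCast_eq_natCast_iff] at hij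
    exact hji ((Nat.ModEq.cancel_left_of_coprime hab hij).eq_of_lt_of_lt (by simpa using hj) hi)
  · intro h
    simp [hi] at h

/-- The factor `∑ s^{ib} T^{a-1-i}` of `T^a - s^{ab}`. -/
def cofactor (k : Type*) [Field k] (a b : ℕ) : (Alg k a b)[X] :=
  ∑ i ∈ Finset.range a, C (sb k a b) ^ i * X ^ (a - 1 - i)

theorem mul_cofactor : (X - C (sb k a b)) * cofactor k a b = X ^ a - C (sb k a b ^ a) := by
  have := Commute.geom_sum₂_mul (Commute.all (C (sb k a b)) (X : (Alg k a b)[X])) a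
  rw [cofactor, C_pow]
  linear_combination -this

theorem polyToEnv_cofactor : polyToEnv k a b (cofactor k a b) = dT₁ k a b := by
  simp [cofactor, dT₁, tm_eq]

theorem polyToEnv_X_sub_C : polyToEnv k a b (X - C (sb k a b)) = - dE₁ k a b := by
  simp [dE₁, tm_eq]

theorem toGroupAlg_polyToEnv_mul_cofactor :
    toGroupAlg k a b (polyToEnv k a b ((X - C (sb k a b)) * cofactor k a b)) = 0 := by
  rw [map_mul, polyToEnv_X_sub_C, polyToEnv_cofactor, neg_mul, dE₁_mul_dT₁_eq, map_neg, map_mul,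
    toGroupAlg_dE₂, zero_mul, neg_zero]

theorem dvd_of_toGroupAlg_polyToEnv (ha : 0 < a) (hab : Nat.Coprime a b) {h : (Alg k a b)[X]}
    (h0 : toGroupAlg k a b (polyToEnv k a b h) = 0) :
    (X - C (sb k a b)) * cofactor k a b ∣ h := by
  have hmon : ((X - C (sb k a b)) * cofactor k a b).Monic := by
    rw [mul_cofactor]
    exact monic_X_pow_sub_C _ ha.ne'
  rw [← modByMonic_eq_zero_iff_dvd hmon]
  apply eq_zero_of_toGroupAlg_polyToEnv hab
  · have := natDegree_modByMonic_lt h hmon (by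
      intro h1
      have := congrArg natDegree h1
      rw [mul_cofactor, natDegree_X_pow_sub_C, natDegree_one] at this
      omega)
    rwa [mul_cofactor, natDegree_X_pow_sub_C, ← mul_cofactor] at this
  · rw [← modByMonic_add_div h ((X - C (sb k a b)) * cofactor k a b), map_add, map_mul, map_add,
      map_mul, toGroupAlg_polyToEnv_mul_cofactor, zero_mul, add_zero] at h0
    exact h0

/-- The kernel of the multiplication map is generated by `d(e₁)` and `d(e₂)`. -/
theorem exists_of_mulMap_eq_zero {x : Env k a b} (hx : mulMap k a b x = 0) :
    ∃ u v, x = dE₁ k a b * u + dE₂ k a b * v := by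
  obtain ⟨h, w, rfl⟩ := exists_eq_polyToEnv_add x
  have h₂ : mulMap k a b (dE₂ k a b) = 0 := by simp [dE₂]
  have h₁ : mulMap k a b (polyToEnv k a b h) = h.eval (sb k a b) := by
    rw [polyToEnv, coe_eval₂RingHom, eval₂_eq_sum, Polynomial.sum, map_sum, eval_eq_sum,
      Polynomial.sum]
    refine Finset.sum_congr rfl fun i _ => ?_
    rw [map_mul, map_pow, inRight_apply, mulMap_tm, one_mul]
    change mulMap k a b (inLeft k a b _) * _ = _
    rw [inLeft_apply, mulMap_tm, mul_one]
  rw [map_add, map_mul, h₂, zero_mul, add_zero, h₁] at hx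
  obtain ⟨g, rfl⟩ := dvd_iff_isRoot.mpr hx
  exact ⟨- polyToEnv k a b g, w, by rw [map_mul, polyToEnv_X_sub_C]; ring⟩

/-- A syzygy between `d(e₁)` and `d(e₂)` is a combination of `d(t)` and the Koszul syzygy. -/
theorem exists_of_dE_add_eq_zero (ha : 0 < a) (hab : Nat.Coprime a b) {u v : Env k a b}
    (huv : dE₁ k a b * u + dE₂ k a b * v = 0) :
    ∃ p w, u = dT₁ k a b * p - dE₂ k a b * w ∧ v = - dT₂ k a b * p + dE₁ k a b * w := by
  obtain ⟨h, w, rfl⟩ := exists_eq_polyToEnv_add u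
  have h0 : toGroupAlg k a b (polyToEnv k a b ((X - C (sb k a b)) * h)) = 0 := by
    have := congrArg (toGroupAlg k a b) huv
    simp only [map_add, map_mul, toGroupAlg_dE₂, zero_mul, add_zero, map_zero] at this
    rw [map_mul, polyToEnv_X_sub_C, neg_mul, map_neg, map_mul, this, neg_zero]
  obtain ⟨g, hg⟩ := dvd_of_toGroupAlg_polyToEnv ha hab h0
  rw [mul_assoc] at hg
  obtain rfl := mul_left_cancel₀ (X_sub_C_ne_zero _) hg
  rw [map_mul, polyToEnv_cofactor] at huv ⊢
  refine ⟨polyToEnv k a b g, -w, by ring, mul_left_cancel₀ (dE₂_ne_zero ha) ?_⟩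
  linear_combination huv - polyToEnv k a b g * dE₁_mul_dT₁_eq (k := k) (a := a) (b := b)

theorem exists_of_dT₁_mul_eq (ha : 0 < a) (hab : Nat.Coprime a b) {p w : Env k a b}
    (h : dT₁ k a b * p = dE₂ k a b * w) :
    ∃ u v, p = dE₁ k a b * u + dE₂ k a b * v ∧ w = dT₂ k a b * u + dT₁ k a b * v := by
  obtain ⟨f, r, rfl⟩ := exists_eq_polyToEnv_add p
  have h0 : toGroupAlg k a b (polyToEnv k a b (f * cofactor k a b)) = 0 := by
    have := congrArg (toGroupAlg k a b) h
    simp only [map_add, map_mul, toGroupAlg_dE₂, zero_mul, add_zero] at this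
    rw [map_mul, map_mul, polyToEnv_cofactor, mul_comm, this]
  obtain ⟨g, hg⟩ := dvd_of_toGroupAlg_polyToEnv ha hab h0
  have hne : cofactor k a b ≠ 0 := by
    intro h
    have := mul_cofactor (k := k) (a := a) (b := b)
    rw [h, mul_zero] at this
    exact (monic_X_pow_sub_C (sb k a b ^ a) ha.ne').ne_zero this.symm
  obtain rfl : f = (X - C (sb k a b)) * g :=
    mul_right_cancel₀ hne (by rw [hg]; ring)
  rw [map_mul, polyToEnv_X_sub_C] at h ⊢
  refine ⟨-polyToEnv k a b g, r, by ring, mul_left_cancel₀ (dE₂_ne_zero ha) ?_⟩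
  linear_combination -h - polyToEnv k a b g * dE₁_mul_dT₁_eq (k := k) (a := a) (b := b)

end

end

/-! ## The resolution -/

noncomputable section

section

theorem GenDeg.even_cases {m q : ℕ} (hm : m = 2 * q + 2) (g : GenDeg m) :
    g.1 = (.one, q + 1) ∨ g.1 = (.e₁₂, q) := by
  obtain ⟨⟨w, j⟩, hg⟩ := g
  cases w <;> simp [Gen.deg, Wedge.deg] at hg ⊢ <;> omega

theorem GenDeg.odd_cases {m q : ℕ} (hm : m = 2 * q + 1) (g : GenDeg m) :
    g.1 = (.e₁, q) ∨ g.1 = (.e₂, q) := by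
  obtain ⟨⟨w, j⟩, hg⟩ := g
  cases w <;> simp [Gen.deg, Wedge.deg] at hg ⊢ <;> omega

theorem GenDeg.zero_cases (g : GenDeg 0) : g.1 = (.one, 0) := by
  obtain ⟨⟨w, j⟩, hg⟩ := g
  cases w <;> simp [Gen.deg, Wedge.deg] at hg ⊢
  omega

/-- The generator `t^{(q)}`. -/
abbrev genOne {m : ℕ} (q : ℕ) (hm : m = 2 * q) : GenDeg m :=
  ⟨(.one, q), by simp [Gen.deg, Wedge.deg, hm]⟩

/-- The generator `e₁ t^{(q)}`. -/
abbrev genE₁ {m : ℕ} (q : ℕ) (hm : m = 2 * q + 1) : GenDeg m :=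
  ⟨(.e₁, q), by simp [Gen.deg, Wedge.deg, hm]; omega⟩

/-- The generator `e₂ t^{(q)}`. -/
abbrev genE₂ {m : ℕ} (q : ℕ) (hm : m = 2 * q + 1) : GenDeg m :=
  ⟨(.e₂, q), by simp [Gen.deg, Wedge.deg, hm]; omega⟩

/-- The generator `e₁ e₂ t^{(q)}`. -/
abbrev genE₁₂ {m : ℕ} (q : ℕ) (hm : m = 2 * q + 2) : GenDeg m :=
  ⟨(.e₁₂, q), by simp [Gen.deg, Wedge.deg, hm]; omega⟩

theorem GenDeg.forall_even {m q : ℕ} (hm : m = 2 * q + 2) {p : GenDeg m → Prop}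
    (h₁ : p (genOne (q + 1) hm)) (h₂ : p (genE₁₂ q hm)) (g : GenDeg m) : p g := by
  obtain h | h := GenDeg.even_cases hm g
  · rwa [show g = genOne (q + 1) hm from Subtype.ext h]
  · rwa [show g = genE₁₂ q hm from Subtype.ext h]

theorem GenDeg.forall_odd {m q : ℕ} (hm : m = 2 * q + 1) {p : GenDeg m → Prop}
    (h₁ : p (genE₁ q hm)) (h₂ : p (genE₂ q hm)) (g : GenDeg m) : p g := by
  obtain h | h := GenDeg.odd_cases hm g
  · rwa [show g = genE₁ q hm from Subtype.ext h]
  · rwa [show g = genE₂ q hm from Subtype.ext h]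

theorem GenDeg.forall_zero {p : GenDeg 0 → Prop} (h : p (genOne 0 rfl)) (g : GenDeg 0) : p g := by
  rwa [show g = genOne 0 rfl from Subtype.ext (GenDeg.zero_cases g)]

variable {k : Type*} [Field k] {a b : ℕ}

theorem d_single_apply {m : ℕ} (g : GenDeg (m + 1)) (u : Env k a b) (g' : GenDeg m) :
    d k a b m (Finsupp.single g u) g' = u * dGen k a b g.1 g'.1 := by
  simp [d, Finsupp.subtypeDomain_apply]

theorem augmentation_single (g : GenDeg 0) (u : Env k a b) :
    augmentation k a b (Finsupp.single g u) = mulMap k a b u := by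
  rw [augmentation, Finsupp.linearCombination_single, smul_eq_mulMap_mul, mul_one]

theorem F.ext_even {m q : ℕ} (hm : m = 2 * q + 2) {x y : F k a b m}
    (h₁ : x (genOne (q + 1) hm) = y (genOne (q + 1) hm))
    (h₂ : x (genE₁₂ q hm) = y (genE₁₂ q hm)) : x = y :=
  Finsupp.ext (GenDeg.forall_even hm h₁ h₂)

theorem F.ext_odd {m q : ℕ} (hm : m = 2 * q + 1) {x y : F k a b m}
    (h₁ : x (genE₁ q hm) = y (genE₁ q hm))
    (h₂ : x (genE₂ q hm) = y (genE₂ q hm)) : x = y :=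
  Finsupp.ext (GenDeg.forall_odd hm h₁ h₂)

theorem F.eq_single_even {m q : ℕ} (hm : m = 2 * q + 2) (x : F k a b m) :
    x = Finsupp.single (genOne (q + 1) hm) (x (genOne (q + 1) hm)) +
      Finsupp.single (genE₁₂ q hm) (x (genE₁₂ q hm)) := by
  classical
  apply F.ext_even hm <;> simp

theorem F.eq_single_odd {m q : ℕ} (hm : m = 2 * q + 1) (x : F k a b m) :
    x = Finsupp.single (genE₁ q hm) (x (genE₁ q hm)) +
      Finsupp.single (genE₂ q hm) (x (genE₂ q hm)) := by
  classical
  apply F.ext_odd hm <;> simp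

theorem F.eq_single_zero (x : F k a b 0) :
    x = Finsupp.single (genOne 0 rfl) (x (genOne 0 rfl)) :=
  Finsupp.ext (GenDeg.forall_zero (by simp))

theorem d_apply_genOne {m q : ℕ} (hm : m = 2 * q) (x : F k a b (m + 1)) :
    d k a b m x (genOne q hm) =
      dE₁ k a b * x (genE₁ q (by omega)) + dE₂ k a b * x (genE₂ q (by omega)) := by
  classical
  rw [F.eq_single_odd (show m + 1 = 2 * q + 1 by omega) x]
  obtain _ | q := q <;> simp [d_single_apply, dGen, mul_comm]

theorem d_apply_genE₁₂ {m q : ℕ} (hm : m = 2 * q + 2) (x : F k a b (m + 1)) :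
    d k a b m x (genE₁₂ q hm) =
      dT₂ k a b * x (genE₁ (q + 1) (by omega)) + dT₁ k a b * x (genE₂ (q + 1) (by omega)) := by
  classical
  rw [F.eq_single_odd (show m + 1 = 2 * (q + 1) + 1 by omega) x]
  simp [d_single_apply, dGen, mul_comm]

theorem d_apply_genE₁ {m q : ℕ} (hm : m = 2 * q + 1) (x : F k a b (m + 1)) :
    d k a b m x (genE₁ q hm) =
      dT₁ k a b * x (genOne (q + 1) (by omega)) - dE₂ k a b * x (genE₁₂ q (by omega)) := by
  classical
  rw [F.eq_single_even (show m + 1 = 2 * q + 2 by omega) x]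
  simp [d_single_apply, dGen, mul_comm, sub_eq_add_neg]

theorem d_apply_genE₂ {m q : ℕ} (hm : m = 2 * q + 1) (x : F k a b (m + 1)) :
    d k a b m x (genE₂ q hm) =
      - dT₂ k a b * x (genOne (q + 1) (by omega)) + dE₁ k a b * x (genE₁₂ q (by omega)) := by
  classical
  rw [F.eq_single_even (show m + 1 = 2 * q + 2 by omega) x]
  simp [d_single_apply, dGen, mul_comm, sub_eq_add_neg]

theorem d_d (m : ℕ) (x : F k a b (m + 2)) : d k a b m (d k a b (m + 1) x) = 0 := by
  obtain ⟨q, hm | hm⟩ := m.even_or_odd'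
  · have h₀ : d k a b m (d k a b (m + 1) x) (genOne q hm) = 0 := by
      rw [d_apply_genOne hm, d_apply_genE₁ (by omega), d_apply_genE₂ (by omega)]
      linear_combination x (genOne (q + 1) (by omega)) *
        dE₁_mul_dT₁_eq (k := k) (a := a) (b := b)
    obtain _ | q := q
    · subst hm
      exact Finsupp.ext (GenDeg.forall_zero h₀)
    · refine F.ext_even hm h₀ ?_
      rw [d_apply_genE₁₂ hm, d_apply_genE₁ (by omega), d_apply_genE₂ (by omega),
        Finsupp.coe_zero, Pi.zero_apply]
      linear_combination x (genE₁₂ (q + 1) (by omega)) *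
        dE₁_mul_dT₁_eq (k := k) (a := a) (b := b)
  · refine F.ext_odd hm ?_ ?_
    · rw [d_apply_genE₁ hm, d_apply_genOne (by omega), d_apply_genE₁₂ (by omega),
        Finsupp.coe_zero, Pi.zero_apply]
      linear_combination x (genE₁ (q + 1) (by omega)) *
        dE₁_mul_dT₁_eq (k := k) (a := a) (b := b)
    · rw [d_apply_genE₂ hm, d_apply_genOne (by omega), d_apply_genE₁₂ (by omega),
        Finsupp.coe_zero, Pi.zero_apply]
      linear_combination x (genE₂ (q + 1) (by omega)) *
        dE₁_mul_dT₁_eq (k := k) (a := a) (b := b)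

theorem exact_d (ha : 0 < a) (hab : Nat.Coprime a b) (m : ℕ) :
    Function.Exact (d k a b (m + 1)) (d k a b m) := by
  classical
  refine LinearMap.exact_of_comp_of_mem_range (LinearMap.ext (d_d m)) fun x hx => ?_
  obtain ⟨q, hm | hm⟩ := m.even_or_odd'
  · have h := DFunLike.congr_fun hx (genOne q hm)
    rw [d_apply_genOne hm] at h
    obtain ⟨p, w, hp, hw⟩ := exists_of_dE_add_eq_zero ha hab h
    refine ⟨Finsupp.single (genOne (q + 1) (by omega)) p +
      Finsupp.single (genE₁₂ q (by omega)) w, ?_⟩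
    refine F.ext_odd (show m + 1 = 2 * q + 1 by omega) ?_ ?_
    · rw [d_apply_genE₁, hp]
      simp
    · rw [d_apply_genE₂, hw]
      simp
  · have h := DFunLike.congr_fun hx (genE₁ q hm)
    rw [d_apply_genE₁ hm, Finsupp.coe_zero, Pi.zero_apply, sub_eq_zero] at h
    obtain ⟨u, v, hu, hv⟩ := exists_of_dT₁_mul_eq ha hab h
    refine ⟨Finsupp.single (genE₁ (q + 1) (by omega)) u +
      Finsupp.single (genE₂ (q + 1) (by omega)) v, ?_⟩
    refine F.ext_even (show m + 1 = 2 * q + 2 by omega) ?_ ?_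
    · rw [d_apply_genOne, hu]
      simp
    · rw [d_apply_genE₁₂, hv]
      simp

theorem exact_augmentation :
    Function.Exact (d k a b 0) (augmentation k a b) := by
  classical
  have h₁ : mulMap k a b (dE₁ k a b) = 0 := by simp [dE₁]
  have h₂ : mulMap k a b (dE₂ k a b) = 0 := by simp [dE₂]
  have h (x : F k a b 0) : augmentation k a b x = mulMap k a b (x (genOne 0 rfl)) := by
    conv_lhs => rw [F.eq_single_zero x, augmentation_single]
  refine LinearMap.exact_of_comp_of_mem_range ?_ fun x hx => ?_
  · refine LinearMap.ext fun x => ?_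
    rw [LinearMap.comp_apply, h, d_apply_genOne, map_add, map_mul, map_mul, h₁, h₂]
    simp
  · rw [h] at hx
    obtain ⟨u, v, huv⟩ := exists_of_mulMap_eq_zero hx
    refine ⟨Finsupp.single (genE₁ 0 (by omega)) u + Finsupp.single (genE₂ 0 (by omega)) v,
      Finsupp.ext (GenDeg.forall_zero ?_)⟩
    rw [d_apply_genOne, huv]
    simp

theorem augmentation_surjective : Function.Surjective (augmentation k a b) := fun u =>
  ⟨Finsupp.single (genOne 0 rfl) (inLeft k a b u), by
    rw [augmentation_single, inLeft_apply, mulMap_tm, mul_one]⟩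

end

end

/-! ## Hochschild cochains and their grading -/

noncomputable section

open Polynomial

/-! ### Gradings from projections -/

section

variable {k ι V : Type*} [Field k] [DecidableEq ι] [AddCommGroup V] [Module k V]

theorem isInternal_of_proj (W : ι → Submodule k V) (p : ι → V →ₗ[k] V)
    (hmem : ∀ n v, p n v ∈ W n) (hself : ∀ n, ∀ v ∈ W n, p n v = v)
    (hne : ∀ i j, i ≠ j → ∀ v ∈ W i, p j v = 0)
    (hsum : ∀ v, ∃ s : Finset ι, v = ∑ n ∈ s, p n v) : DirectSum.IsInternal W := by
  have hcoe (x : DirectSum ι fun i => W i) (i : ι) :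
      p i (DirectSum.coeAddMonoidHom W x) = x i := by
    induction x using DirectSum.induction_on with
    | zero => simp
    | of j v =>
      rw [DirectSum.coeAddMonoidHom_of]
      obtain rfl | h := eq_or_ne j i
      · rw [hself _ _ v.2, DirectSum.of_eq_same]
      · rw [hne _ _ h _ v.2, DirectSum.of_eq_of_ne _ _ _ h.symm]
        rfl
    | add x y hx hy => rw [map_add, map_add, hx, hy]; rfl
  constructor
  · rw [injective_iff_map_eq_zero]
    intro x hx
    refine DFinsupp.ext fun i => Subtype.ext ?_
    rw [← hcoe, hx, map_zero]
    rfl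
  · intro v
    obtain ⟨s, hs⟩ := hsum v
    refine ⟨∑ n ∈ s, DirectSum.of (fun i => W i) n ⟨p n v, hmem n v⟩, ?_⟩
    rw [map_sum]
    simp only [DirectSum.coeAddMonoidHom_of]
    exact hs.symm

theorem isInternal_quotient_of_proj (Z B : Submodule k V) (W : ι → Submodule k V)
    (p : ι → V →ₗ[k] V)
    (hmem : ∀ n v, p n v ∈ W n) (hself : ∀ n, ∀ v ∈ W n, p n v = v)
    (hne : ∀ i j, i ≠ j → ∀ v ∈ W i, p j v = 0)
    (hsum : ∀ v, ∃ s : Finset ι, v = ∑ n ∈ s, p n v)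
    (hZ : ∀ n, ∀ v ∈ Z, p n v ∈ Z) (hB : ∀ n, ∀ v ∈ B, p n v ∈ B) :
    DirectSum.IsInternal fun n => ((W n).submoduleOf Z).map (B.submoduleOf Z).mkQ := by
  let pbar (n : ι) : (Z ⧸ B.submoduleOf Z) →ₗ[k] (Z ⧸ B.submoduleOf Z) :=
    Submodule.mapQ _ _ ((p n).restrict (hZ n)) fun v hv => hB n v hv
  have hp (n : ι) (z : Z) : pbar n ((B.submoduleOf Z).mkQ z) =
    (B.submoduleOf Z).mkQ ((p n).restrict (hZ n) z) := rfl
  refine isInternal_of_proj _ pbar ?_ ?_ ?_ ?_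
  · intro n v
    obtain ⟨z, rfl⟩ := Submodule.mkQ_surjective _ v
    rw [hp]
    exact Submodule.mem_map_of_mem (hmem n z)
  · rintro n _ ⟨z, hz, rfl⟩
    rw [hp]
    congr 1
    exact Subtype.ext (hself n _ hz)
  · rintro i j hij _ ⟨z, hz, rfl⟩
    rw [hp, show (p j).restrict (hZ j) z = 0 from Subtype.ext (hne i j hij _ hz), map_zero]
  · intro v
    obtain ⟨z, rfl⟩ := Submodule.mkQ_surjective _ v
    obtain ⟨s, hs⟩ := hsum z
    refine ⟨s, ?_⟩
    simp only [hp]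
    rw [← map_sum]
    congr 1
    apply Subtype.ext
    rw [AddSubmonoidClass.coe_finsetSum]
    exact hs

end

section

variable {k : Type*} [Field k] {a b : ℕ}

/-! ### The grading of the algebra -/

theorem inSemigroup_of_coeff_ne_zero (u : Alg k a b) :
    ∀ n : ℕ, (toPoly k a b u).coeff n ≠ 0 → InSemigroup a b n := by
  induction u using Alg.induction with
  | algebraMap c =>
    intro n hn
    rw [AlgHom.commutes, Polynomial.algebraMap_apply, coeff_C] at hn
    obtain rfl : n = 0 := by by_contra h; simp [h] at hn
    exact InSemigroup.zero a b
  | sa =>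
    intro n hn
    rw [toPoly_sa, coeff_X_pow] at hn
    obtain rfl : n = a := by by_contra h; simp [h] at hn
    exact InSemigroup.left_mem
  | sb =>
    intro n hn
    rw [toPoly_sb, coeff_X_pow] at hn
    obtain rfl : n = b := by by_contra h; simp [h] at hn
    exact InSemigroup.right_mem
  | add u v hu hv =>
    intro n hn
    rw [map_add, coeff_add] at hn
    by_cases h : (toPoly k a b u).coeff n = 0
    · exact hv n fun h' => hn (by rw [h, h', add_zero])
    · exact hu n h
  | mul u v hu hv =>
    intro n hn
    rw [map_mul, coeff_mul] at hn
    obtain ⟨⟨i, j⟩, hij, h⟩ := Finset.exists_ne_zero_of_sum_ne_zero hn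
    have := (hu i (left_ne_zero_of_mul h)).add (hv j (right_ne_zero_of_mul h))
    rw [Finset.HasAntidiagonal.mem_antidiagonal] at hij
    rw [← hij]
    exact_mod_cast this

theorem exists_toPoly_eq {n : ℤ} (hn : InSemigroup a b n) :
    ∃ u : Alg k a b, toPoly k a b u = X ^ n.toNat := by
  obtain ⟨i, j, rfl⟩ := hn
  refine ⟨sa k a b ^ i * sb k a b ^ j, ?_⟩
  rw [map_mul, map_pow, map_pow, toPoly_sa, toPoly_sb, ← pow_mul, ← pow_mul, ← pow_add]
  congr 1

open Classical in
variable (k a b) in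
/-- The monomial `s^n` if it lies in `A`, and zero otherwise. -/
def monom (n : ℤ) : Alg k a b :=
  if h : InSemigroup a b n then (exists_toPoly_eq h).choose else 0

theorem toPoly_monom {n : ℤ} (h : InSemigroup a b n) :
    toPoly k a b (monom k a b n) = X ^ n.toNat := by
  rw [monom, dif_pos h]
  exact (exists_toPoly_eq h).choose_spec

theorem monom_of_not {n : ℤ} (h : ¬ InSemigroup a b n) : monom k a b n = 0 := by
  rw [monom, dif_neg h]

theorem monom_ne_zero {n : ℤ} (h : InSemigroup a b n) : monom k a b n ≠ 0 := by
  intro h0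
  have := toPoly_monom (k := k) h
  rw [h0, map_zero] at this
  exact pow_ne_zero _ X_ne_zero this.symm

theorem monom_mul {m n : ℤ} (hm : InSemigroup a b m) (hn : InSemigroup a b n) :
    monom k a b m * monom k a b n = monom k a b (m + n) := by
  apply toPoly_injective
  rw [map_mul, toPoly_monom hm, toPoly_monom hn, toPoly_monom (hm.add hn), ← pow_add,
    Int.toNat_add hm.nonneg hn.nonneg]

theorem monom_coeff {n : ℤ} (h : InSemigroup a b n) (i : ℕ) :
    (toPoly k a b (monom k a b n)).coeff i = if (i : ℤ) = n then 1 else 0 := by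
  have := h.nonneg
  rw [toPoly_monom h, coeff_X_pow]
  congr 1
  rw [eq_iff_iff]
  omega

variable (k a b) in
/-- The projection of `A` to its homogeneous component of degree `n`. -/
def algProj (n : ℤ) : Alg k a b →ₗ[k] Alg k a b :=
  ((Polynomial.lcoeff k n.toNat).comp (toPoly k a b).toLinearMap).smulRight (monom k a b n)

theorem algProj_apply (n : ℤ) (u : Alg k a b) :
    algProj k a b n u = (toPoly k a b u).coeff n.toNat • monom k a b n := rfl

theorem algProj_coeff (n : ℤ) (u : Alg k a b) (i : ℕ) :
    (toPoly k a b (algProj k a b n u)).coeff i =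
      if (i : ℤ) = n then (toPoly k a b u).coeff i else 0 := by
  rw [algProj_apply, map_smul, coeff_smul, smul_eq_mul]
  by_cases h : InSemigroup a b n
  · rw [monom_coeff h]
    split_ifs with hi
    · subst hi; simp
    · simp
  · rw [monom_of_not h, map_zero, coeff_zero, mul_zero]
    split_ifs with hi
    · subst hi
      by_contra h'
      exact h (inSemigroup_of_coeff_ne_zero u i (Ne.symm h'))
    · rfl

theorem Alg.ext_coeff {u v : Alg k a b}
    (h : ∀ i, (toPoly k a b u).coeff i = (toPoly k a b v).coeff i) : u = v :=
  toPoly_injective (Polynomial.ext h)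

theorem mem_algPiece_iff {n : ℤ} {u : Alg k a b} :
    u ∈ algPiece k a b n ↔ ∃ c : k, u = c • monom k a b n := by
  constructor
  · intro h
    induction h using Submodule.span_induction with
    | mem u hu =>
      obtain ⟨α, rfl, hu⟩ := hu
      have h : InSemigroup a b α := inSemigroup_of_coeff_ne_zero u α (by simp [hu])
      refine ⟨1, toPoly_injective ?_⟩
      rw [hu, one_smul, toPoly_monom h, Int.toNat_natCast]
    | zero => exact ⟨0, by simp⟩
    | add u v _ _ hu hv =>
      obtain ⟨c, rfl⟩ := hu
      obtain ⟨c', rfl⟩ := hv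
      exact ⟨c + c', by rw [add_smul]⟩
    | smul c u _ hu =>
      obtain ⟨c', rfl⟩ := hu
      exact ⟨c * c', by rw [mul_smul]⟩
  · rintro ⟨c, rfl⟩
    apply Submodule.smul_mem
    by_cases h : InSemigroup a b n
    · exact Submodule.subset_span ⟨n.toNat, Int.toNat_of_nonneg h.nonneg, toPoly_monom h⟩
    · rw [monom_of_not h]
      exact Submodule.zero_mem _

theorem algProj_mem (n : ℤ) (u : Alg k a b) : algProj k a b n u ∈ algPiece k a b n :=
  mem_algPiece_iff.mpr ⟨_, rfl⟩

theorem algPiece_coeff {n : ℤ} {u : Alg k a b} (hu : u ∈ algPiece k a b n) {i : ℕ}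
    (hi : (i : ℤ) ≠ n) : (toPoly k a b u).coeff i = 0 := by
  obtain ⟨c, rfl⟩ := mem_algPiece_iff.mp hu
  rw [map_smul, coeff_smul]
  by_cases h : InSemigroup a b n
  · rw [monom_coeff h, if_neg hi, smul_zero]
  · rw [monom_of_not h, map_zero, coeff_zero, smul_zero]

theorem algProj_self {n : ℤ} {u : Alg k a b} (hu : u ∈ algPiece k a b n) :
    algProj k a b n u = u := by
  refine Alg.ext_coeff fun i => ?_
  rw [algProj_coeff]
  split_ifs with h
  · rfl
  · exact (algPiece_coeff hu h).symm

theorem algProj_of_ne {m n : ℤ} (h : m ≠ n) {u : Alg k a b} (hu : u ∈ algPiece k a b m) :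
    algProj k a b n u = 0 := by
  refine Alg.ext_coeff fun i => ?_
  rw [algProj_coeff, map_zero, coeff_zero]
  split_ifs with hi
  · exact algPiece_coeff hu (by rw [hi]; exact h.symm)
  · rfl

theorem algProj_monom_mul {m n l : ℤ} (hm : InSemigroup a b m) (hl : l = m + n) (u : Alg k a b) :
    algProj k a b l (monom k a b m * u) = monom k a b m * algProj k a b n u := by
  subst hl
  have := hm.nonneg
  refine Alg.ext_coeff fun i => ?_
  rw [algProj_coeff, map_mul, map_mul, toPoly_monom hm, coeff_X_pow_mul', coeff_X_pow_mul',
    algProj_coeff]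
  split_ifs <;> first | rfl | omega

/-! ### Cochains -/

theorem Cochain.apply_single {m : ℕ} (f : Cochain k a b m) (g : GenDeg m) (u : Env k a b) :
    (show F k a b m →ₗ[Env k a b] Alg k a b from f) (Finsupp.single g u) =
      mulMap k a b u * f.value g := by
  rw [← smul_eq_mulMap_mul, Cochain.value, ← map_smul, Finsupp.smul_single, smul_eq_mul, mul_one]

theorem Cochain.ext {m : ℕ} {f f' : Cochain k a b m} (h : ∀ g, f.value g = f'.value g) :
    f = f' := by
  refine Finsupp.lhom_ext fun g u => ?_
  have h₁ := f.apply_single g u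
  have h₂ := f'.apply_single g u
  rw [← h g] at h₂
  exact h₁.trans h₂.symm

theorem Cochain.value_add {m : ℕ} (f f' : Cochain k a b m) (g : GenDeg m) :
    (f + f').value g = f.value g + f'.value g := rfl

theorem Cochain.value_smul {m : ℕ} (c : k) (f : Cochain k a b m) (g : GenDeg m) :
    (c • f).value g = c • f.value g := rfl

theorem Cochain.value_zero {m : ℕ} (g : GenDeg m) : (0 : Cochain k a b m).value g = 0 := rfl

variable (k a b) in
/-- The value at a basis element, as a linear map. -/
def valueLinear {m : ℕ} (g : GenDeg m) : Cochain k a b m →ₗ[k] Alg k a b where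
  toFun f := f.value g
  map_add' _ _ := rfl
  map_smul' _ _ := rfl

/-- The cochain with given values on the basis. -/
def Cochain.ofValues {m : ℕ} (v : GenDeg m → Alg k a b) : Cochain k a b m :=
  (Finsupp.linearCombination (Env k a b) v : F k a b m →ₗ[Env k a b] Alg k a b)

@[simp] theorem Cochain.value_ofValues {m : ℕ} (v : GenDeg m → Alg k a b) (g : GenDeg m) :
    (Cochain.ofValues v).value g = v g :=
  (Finsupp.linearCombination_single _ _ _).trans (one_smul _ _)

theorem mulMap_dT₁ (ha : 0 < a) :
    mulMap k a b (dT₁ k a b) = (a : k) • monom k a b (m₁ a b) := by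
  have h : monom k a b (m₁ a b) = sb k a b ^ (a - 1) := by
    apply toPoly_injective
    rw [toPoly_monom (InSemigroup.m₁_mem ha), map_pow, toPoly_sb, ← pow_mul]
    congr 1
    zify [show 1 ≤ a from ha]
    rw [Int.toNat_of_nonneg (InSemigroup.m₁_mem ha).nonneg, m₁]
  rw [dT₁, map_sum, h, Finset.sum_congr rfl (g := fun _ => sb k a b ^ (a - 1)),
    Finset.sum_const, Finset.card_range, Nat.cast_smul_eq_nsmul]
  intro i hi
  rw [Finset.mem_range] at hi
  rw [mulMap_tm, ← pow_add]
  congr 1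
  omega

theorem mulMap_dT₂ (hb : 0 < b) :
    mulMap k a b (dT₂ k a b) = (b : k) • monom k a b (m₂ a b) := by
  have h : monom k a b (m₂ a b) = sa k a b ^ (b - 1) := by
    apply toPoly_injective
    rw [toPoly_monom (InSemigroup.m₂_mem hb), map_pow, toPoly_sa, ← pow_mul]
    congr 1
    zify [show 1 ≤ b from hb]
    rw [Int.toNat_of_nonneg (InSemigroup.m₂_mem hb).nonneg, m₂]
  rw [dT₂, map_sum, h, Finset.sum_congr rfl (g := fun _ => sa k a b ^ (b - 1)),
    Finset.sum_const, Finset.card_range, Nat.cast_smul_eq_nsmul]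
  intro i hi
  rw [Finset.mem_range] at hi
  rw [mulMap_tm, ← pow_add]
  congr 1
  omega

theorem coboundary_value {m : ℕ} (f : Cochain k a b m) (g : GenDeg (m + 1)) :
    (coboundary k a b m f).value g =
      (show F k a b m →ₗ[Env k a b] Alg k a b from f) (d k a b m (Finsupp.single g 1)) := rfl

theorem Cochain.apply_even {m q : ℕ} (hm : m = 2 * q + 2) (f : Cochain k a b m) (x : F k a b m) :
    (show F k a b m →ₗ[Env k a b] Alg k a b from f) x =
      mulMap k a b (x (genOne (q + 1) hm)) * f.value (genOne (q + 1) hm) +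
        mulMap k a b (x (genE₁₂ q hm)) * f.value (genE₁₂ q hm) := by
  conv_lhs => rw [F.eq_single_even hm x, map_add, f.apply_single, f.apply_single]

theorem Cochain.apply_odd {m q : ℕ} (hm : m = 2 * q + 1) (f : Cochain k a b m) (x : F k a b m) :
    (show F k a b m →ₗ[Env k a b] Alg k a b from f) x =
      mulMap k a b (x (genE₁ q hm)) * f.value (genE₁ q hm) +
        mulMap k a b (x (genE₂ q hm)) * f.value (genE₂ q hm) := by
  conv_lhs => rw [F.eq_single_odd hm x, map_add, f.apply_single, f.apply_single]

theorem mulMap_dE₁ : mulMap k a b (dE₁ k a b) = 0 := by simp [dE₁]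

theorem mulMap_dE₂ : mulMap k a b (dE₂ k a b) = 0 := by simp [dE₂]

theorem coboundary_value_genOne (ha : 0 < a) (hb : 0 < b) {m q : ℕ} (hm : m = 2 * q + 1)
    (f : Cochain k a b m) :
    (coboundary k a b m f).value (genOne (q + 1) (by omega)) =
      (a : k) • (monom k a b (m₁ a b) * f.value (genE₁ q hm)) -
        (b : k) • (monom k a b (m₂ a b) * f.value (genE₂ q hm)) := by
  rw [coboundary_value, f.apply_odd hm, d_single_apply, d_single_apply]
  simp [dGen, mulMap_dT₁ ha, mulMap_dT₂ hb, sub_eq_add_neg]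

theorem coboundary_value_genE₁₂ {m q : ℕ} (hm : m = 2 * q + 1) (f : Cochain k a b m) :
    (coboundary k a b m f).value (genE₁₂ q (by omega)) = 0 := by
  rw [coboundary_value, f.apply_odd hm, d_single_apply, d_single_apply]
  simp [dGen, mulMap_dE₁, mulMap_dE₂]

theorem coboundary_zero (f : Cochain k a b 0) : coboundary k a b 0 f = 0 := by
  have h (x : F k a b 0) : (show F k a b 0 →ₗ[Env k a b] Alg k a b from f) x =
      mulMap k a b (x (genOne 0 rfl)) * f.value (genOne 0 rfl) := by
    conv_lhs => rw [F.eq_single_zero x, f.apply_single]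
  refine Cochain.ext (GenDeg.forall_odd (q := 0) rfl ?_ ?_) <;>
  · rw [coboundary_value, h, d_single_apply, Cochain.value_zero]
    simp [dGen, mulMap_dE₁, mulMap_dE₂]

theorem coboundary_value_genE₁ (hb : 0 < b) {m q : ℕ} (hm : m = 2 * q + 2)
    (f : Cochain k a b m) :
    (coboundary k a b m f).value (genE₁ (q + 1) (by omega)) =
      (b : k) • (monom k a b (m₂ a b) * f.value (genE₁₂ q hm)) := by
  rw [coboundary_value, f.apply_even hm, d_single_apply, d_single_apply]
  simp [dGen, mulMap_dE₁, mulMap_dT₂ hb]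

theorem coboundary_value_genE₂ (ha : 0 < a) {m q : ℕ} (hm : m = 2 * q + 2)
    (f : Cochain k a b m) :
    (coboundary k a b m f).value (genE₂ (q + 1) (by omega)) =
      (a : k) • (monom k a b (m₁ a b) * f.value (genE₁₂ q hm)) := by
  rw [coboundary_value, f.apply_even hm, d_single_apply, d_single_apply]
  simp [dGen, mulMap_dE₂, mulMap_dT₁ ha]

/-! ### The grading of the cochains and of the cohomology -/

variable (k a b) in
/-- The projection of the cochains to the component of weight `n`. -/
def cochainProj (m : ℕ) (n : ℤ) : Cochain k a b m →ₗ[k] Cochain k a b m where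
  toFun f := Cochain.ofValues fun g => algProj k a b (n + g.1.weight a b) (f.value g)
  map_add' f f' := Cochain.ext fun g => by
    simp only [Cochain.value_add, Cochain.value_ofValues, map_add]
  map_smul' c f := Cochain.ext fun g => by
    simp only [Cochain.value_smul, Cochain.value_ofValues, map_smul, RingHom.id_apply]

@[simp] theorem cochainProj_value {m : ℕ} (n : ℤ) (f : Cochain k a b m) (g : GenDeg m) :
    (cochainProj k a b m n f).value g = algProj k a b (n + g.1.weight a b) (f.value g) :=
  Cochain.value_ofValues _ _

theorem cochainProj_coboundary (ha : 0 < a) (hb : 0 < b) {m : ℕ} (n : ℤ) (f : Cochain k a b m) :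
    cochainProj k a b (m + 1) n (coboundary k a b m f) =
      coboundary k a b m (cochainProj k a b m n f) := by
  have h₁ := InSemigroup.m₁_mem (b := b) ha
  have h₂ := InSemigroup.m₂_mem (a := a) hb
  obtain ⟨q, hm | hm⟩ := m.even_or_odd'
  · obtain _ | q := q
    · obtain rfl : m = 0 := by omega
      rw [coboundary_zero, coboundary_zero, map_zero]
    · refine Cochain.ext (GenDeg.forall_odd (q := q + 1) (by omega) ?_ ?_)
      · rw [cochainProj_value, coboundary_value_genE₁ hb (by omega),
          coboundary_value_genE₁ hb (by omega), map_smul, cochainProj_value,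
          algProj_monom_mul h₂]
        simp only [Gen.weight, m₂]
        push_cast
        ring
      · rw [cochainProj_value, coboundary_value_genE₂ ha (by omega),
          coboundary_value_genE₂ ha (by omega), map_smul, cochainProj_value,
          algProj_monom_mul h₁]
        simp only [Gen.weight, m₁]
        push_cast
        ring
  · refine Cochain.ext (GenDeg.forall_even (q := q) (by omega) ?_ ?_)
    · rw [cochainProj_value, coboundary_value_genOne ha hb hm, coboundary_value_genOne ha hb hm,
        map_sub, map_smul, map_smul, cochainProj_value, cochainProj_value,
        algProj_monom_mul h₁, algProj_monom_mul h₂]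
      · simp only [Gen.weight, m₂]
        push_cast
        ring
      · simp only [Gen.weight, m₁]
        push_cast
        ring
    · rw [cochainProj_value, coboundary_value_genE₁₂ hm, coboundary_value_genE₁₂ hm, map_zero]

instance : Finite Wedge :=
  Finite.of_surjective (fun i : Fin 4 => ![Wedge.one, .e₁, .e₂, .e₁₂] i) fun w => by
    cases w
    exacts [⟨0, rfl⟩, ⟨1, rfl⟩, ⟨2, rfl⟩, ⟨3, rfl⟩]

instance (m : ℕ) : Finite (GenDeg m) := by
  refine Finite.of_injective (β := Wedge × Fin (m + 1))
    (fun g => (g.1.1, ⟨g.1.2, by have := g.2; simp only [Gen.deg] at this; omega⟩)) ?_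
  rintro ⟨⟨w, q⟩, h⟩ ⟨⟨w', q'⟩, h'⟩ heq
  simpa using heq

theorem exists_eq_sum_cochainProj {m : ℕ} (f : Cochain k a b m) :
    ∃ s : Finset ℤ, f = ∑ n ∈ s, cochainProj k a b m n f := by
  classical
  have := Fintype.ofFinite (GenDeg m)
  refine ⟨Finset.univ.biUnion fun g : GenDeg m =>
    (toPoly k a b (f.value g)).support.image fun i : ℕ => (i : ℤ) - g.1.weight a b, ?_⟩
  refine Cochain.ext fun g => Alg.ext_coeff fun i => ?_
  change _ = (toPoly k a b (valueLinear k a b g (∑ n ∈ _, cochainProj k a b m n f))).coeff i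
  rw [map_sum, map_sum, finsetSum_coeff]
  change _ = ∑ n ∈ _, (toPoly k a b ((cochainProj k a b m n f).value g)).coeff i
  simp only [cochainProj_value, algProj_coeff]
  have h (n : ℤ) : (i : ℤ) = n + g.1.weight a b ↔ (i : ℤ) - g.1.weight a b = n := by
    rw [sub_eq_iff_eq_add]
  simp only [h]
  rw [Finset.sum_ite_eq]
  split_ifs with hi
  · rfl
  · by_contra h0
    refine hi (Finset.mem_biUnion.mpr ⟨g, Finset.mem_univ _, Finset.mem_image.mpr ⟨i, ?_, rfl⟩⟩)
    exact mem_support_iff.mpr h0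

theorem isInternal_HHPiece (ha : 0 < a) (hb : 0 < b) (m : ℕ) :
    DirectSum.IsInternal (fun n : ℤ => HHPiece k a b m n) := by
  refine isInternal_quotient_of_proj _ _ _ (cochainProj k a b m) ?_ ?_ ?_
    exists_eq_sum_cochainProj ?_ ?_
  · intro n f g
    rw [cochainProj_value]
    exact algProj_mem _ _
  · intro n f hf
    refine Cochain.ext fun g => ?_
    rw [cochainProj_value, algProj_self (hf g)]
  · intro i j hij f hf
    refine Cochain.ext fun g => ?_
    rw [cochainProj_value, algProj_of_ne (by simpa using hij) (hf g), Cochain.value_zero]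
  · intro n f hf
    rw [LinearMap.mem_ker] at hf ⊢
    rw [← cochainProj_coboundary ha hb, hf, map_zero]
  · intro n f hf
    cases m with
    | zero =>
      rw [(Submodule.mem_bot k).mp hf, map_zero]
      exact Submodule.zero_mem _
    | succ m =>
      obtain ⟨f, rfl⟩ := hf
      rw [cochainProj_coboundary ha hb]
      exact ⟨_, rfl⟩

end

end

/-! ## Dimensions of the components -/

noncomputable section

open Polynomial

section

variable {k : Type*} [Field k] {a b : ℕ}

theorem finrank_HHPiece_of_span {m : ℕ} {n : ℤ} {c : Cochain k a b m} {p : Prop} [Decidable p]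
    (hc : c ∈ cocycles k a b m) (hcn : c ∈ cochainPiece k a b m n)
    (hspan : ∀ f ∈ cochainPiece k a b m n, f ∈ cocycles k a b m → ∃ r : k, f = r • c)
    (hp : c ∈ coboundaries k a b m ↔ ¬ p) :
    Module.Finite k (HHPiece k a b m n) ∧
      Module.finrank k (HHPiece k a b m n) = if p then 1 else 0 := by
  let z : HH k a b m := ((coboundaries k a b m).submoduleOf (cocycles k a b m)).mkQ ⟨c, hc⟩
  have h : HHPiece k a b m n = Submodule.span k {z} := by
    apply le_antisymm
    · rintro _ ⟨f, hf, rfl⟩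
      obtain ⟨r, hr⟩ := hspan f hf f.2
      rw [show f = r • (⟨c, hc⟩ : cocycles k a b m) from Subtype.ext hr, map_smul]
      exact Submodule.smul_mem _ _ (Submodule.mem_span_singleton_self _)
    · rw [Submodule.span_singleton_le_iff_mem]
      exact Submodule.mem_map_of_mem hcn
  have hz : z = 0 ↔ ¬ p := by
    rw [← hp]
    exact Submodule.Quotient.mk_eq_zero _
  rw [h]
  refine ⟨inferInstance, ?_⟩
  split_ifs with h'
  · exact finrank_span_singleton fun h0 => hz.mp h0 h'
  · rw [hz.mpr h']
    simp

theorem inSemigroup_of_coeff_monom_mul_ne_zero {m : ℤ} (hm : InSemigroup a b m) {u : Alg k a b}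
    {i : ℕ} (h : (toPoly k a b (monom k a b m * u)).coeff i ≠ 0) : InSemigroup a b (i - m) := by
  rw [map_mul, toPoly_monom hm, coeff_X_pow_mul'] at h
  split_ifs at h with hi
  · convert inSemigroup_of_coeff_ne_zero u _ h using 1
    have := hm.nonneg
    omega
  · exact absurd rfl h

theorem inSemigroup_of_monom_eq_monom_mul {m n : ℤ} (hm : InSemigroup a b m)
    (hn : InSemigroup a b n) {u : Alg k a b} (h : monom k a b n = monom k a b m * u) :
    InSemigroup a b (n - m) := by
  have := inSemigroup_of_coeff_monom_mul_ne_zero hm (u := u) (i := n.toNat) (by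
    rw [← h, monom_coeff hn, Int.toNat_of_nonneg hn.nonneg]
    simp)
  rwa [Int.toNat_of_nonneg hn.nonneg] at this

theorem monom_mul_sub {m n : ℤ} (hm : InSemigroup a b m) (hn : InSemigroup a b (n - m)) :
    monom k a b m * monom k a b (n - m) = monom k a b n := by
  rw [monom_mul hm hn, add_sub_cancel]

theorem exists_value_eq {m : ℕ} {n N : ℤ} {f : Cochain k a b m} (hf : f ∈ cochainPiece k a b m n)
    (g : GenDeg m) (hN : n + g.1.weight a b = N) : ∃ r : k, f.value g = r • monom k a b N := by
  subst hN
  exact mem_algPiece_iff.mp (hf g)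

theorem smul_monom_mem (r : k) {n N : ℤ} (h : N = n) :
    r • monom k a b n ∈ algPiece k a b N :=
  h ▸ mem_algPiece_iff.mpr ⟨r, rfl⟩

open Classical in
theorem finrank_HHPiece_zero (n : ℤ) :
    Module.Finite k (HHPiece k a b 0 n) ∧
      Module.finrank k (HHPiece k a b 0 n) = if InSemigroup a b n then 1 else 0 := by
  refine finrank_HHPiece_of_span (c := .ofValues fun _ => (1 : k) • monom k a b n)
    (coboundary_zero _) (GenDeg.forall_zero ?_) ?_ ?_
  · rw [Cochain.value_ofValues]
    exact smul_monom_mem _ (by simp [Gen.weight])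
  · intro f hf _
    obtain ⟨r, hr⟩ := exists_value_eq (N := n) hf (genOne 0 rfl) (by simp [Gen.weight])
    refine ⟨r, Cochain.ext (GenDeg.forall_zero ?_)⟩
    rw [hr, Cochain.value_smul, Cochain.value_ofValues, one_smul]
  · constructor
    · intro h hn
      have := congrArg (fun f => Cochain.value f (genOne 0 rfl)) ((Submodule.mem_bot k).mp h)
      simp only [Cochain.value_ofValues, one_smul] at this
      exact monom_ne_zero hn this
    · intro hn
      refine (Submodule.mem_bot k).mpr (Cochain.ext fun g => ?_)
      rw [Cochain.value_ofValues, monom_of_not hn, smul_zero, Cochain.value_zero]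

open Classical in
theorem finrank_HHPiece_even (ha : 0 < a) (hb : 0 < b) (hka : (a : k) ≠ 0) (hkb : (b : k) ≠ 0)
    (q : ℕ) {n N : ℤ} (hN : N = n + a * b * (q + 1)) :
    Module.Finite k (HHPiece k a b (2 * q + 2) n) ∧
      Module.finrank k (HHPiece k a b (2 * q + 2) n) =
        if InSemigroup a b N ∧ ¬ InSemigroup a b (N - m₁ a b) ∧ ¬ InSemigroup a b (N - m₂ a b)
        then 1 else 0 := by
  have h₁ := InSemigroup.m₁_mem (b := b) ha
  have h₂ := InSemigroup.m₂_mem (a := a) hb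
  have hw : n + Gen.weight a b (.one, q + 1) = N := by
    rw [hN, Gen.weight]; push_cast; ring
  refine finrank_HHPiece_of_span (c := .ofValues fun g => match g.1.1 with
    | .one => monom k a b N
    | _ => 0) ?_ (GenDeg.forall_even rfl ?_ ?_) ?_ ?_
  · refine LinearMap.mem_ker.mpr (Cochain.ext (GenDeg.forall_odd (q := q + 1) (by omega) ?_ ?_))
    · rw [coboundary_value_genE₁ hb rfl, Cochain.value_ofValues, mul_zero, smul_zero,
        Cochain.value_zero]
    · rw [coboundary_value_genE₂ ha rfl, Cochain.value_ofValues, mul_zero, smul_zero,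
        Cochain.value_zero]
  · rw [Cochain.value_ofValues, ← one_smul k (monom k a b N)]
    exact smul_monom_mem _ hw
  · rw [Cochain.value_ofValues]
    exact Submodule.zero_mem _
  · intro f hf hfZ
    obtain ⟨r, hr⟩ := exists_value_eq hf (genOne (q + 1) rfl) hw
    have h0 : f.value (genE₁₂ q rfl) = 0 := by
      have := coboundary_value_genE₁ hb rfl f
      rw [LinearMap.mem_ker.mp hfZ, Cochain.value_zero, eq_comm, smul_eq_zero_iff_right hkb] at this
      exact (mul_eq_zero.mp this).resolve_left (monom_ne_zero h₂)
    refine ⟨r, Cochain.ext (GenDeg.forall_even rfl ?_ ?_)⟩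
    · rw [hr, Cochain.value_smul, Cochain.value_ofValues]
    · rw [h0, Cochain.value_smul, Cochain.value_ofValues, smul_zero]
  · constructor
    · rintro ⟨f, hf⟩ ⟨hn, hn₁, hn₂⟩
      have h := coboundary_value_genOne ha hb rfl f
      rw [hf, Cochain.value_ofValues] at h
      have h := congrArg (fun u => (toPoly k a b u).coeff N.toNat) h
      simp only [map_sub, map_smul, coeff_sub, coeff_smul] at h
      rw [monom_coeff hn, Int.toNat_of_nonneg hn.nonneg, if_pos rfl] at h
      have hz₁ : (toPoly k a b (monom k a b (m₁ a b) * f.value (genE₁ q rfl))).coeff N.toNat = 0 :=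
        by_contra fun h0 => hn₁ <| by
          simpa only [Int.toNat_of_nonneg hn.nonneg] using
            inSemigroup_of_coeff_monom_mul_ne_zero h₁ h0
      have hz₂ : (toPoly k a b (monom k a b (m₂ a b) * f.value (genE₂ q rfl))).coeff N.toNat = 0 :=
        by_contra fun h0 => hn₂ <| by
          simpa only [Int.toNat_of_nonneg hn.nonneg] using
            inSemigroup_of_coeff_monom_mul_ne_zero h₂ h0
      rw [hz₁, hz₂] at h
      simp at h
    · intro h
      have key (u v : Alg k a b) (huv : monom k a b N = (a : k) • (monom k a b (m₁ a b) * u) -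
          (b : k) • (monom k a b (m₂ a b) * v)) :
          (Cochain.ofValues fun g : GenDeg (2 * q + 2) => match g.1.1 with
            | .one => monom k a b N
            | _ => 0) ∈ coboundaries k a b (2 * q + 2) := by
        refine ⟨.ofValues fun g => match g.1.1 with
          | .e₁ => u
          | .e₂ => v
          | _ => 0, Cochain.ext (GenDeg.forall_even rfl ?_ ?_)⟩
        · rw [coboundary_value_genOne ha hb rfl, Cochain.value_ofValues, Cochain.value_ofValues,
            Cochain.value_ofValues, huv]
        · rw [coboundary_value_genE₁₂ rfl, Cochain.value_ofValues]
      by_cases hn₁ : InSemigroup a b (N - m₁ a b)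
      · refine key ((a : k)⁻¹ • monom k a b (N - m₁ a b)) 0 ?_
        rw [mul_smul_comm, smul_smul, mul_inv_cancel₀ hka, one_smul, monom_mul_sub h₁ hn₁]
        simp
      by_cases hn₂ : InSemigroup a b (N - m₂ a b)
      · refine key 0 (-(b : k)⁻¹ • monom k a b (N - m₂ a b)) ?_
        rw [mul_smul_comm, smul_smul, mul_neg, mul_inv_cancel₀ hkb, monom_mul_sub h₂ hn₂]
        simp
      · refine key 0 0 ?_
        rw [monom_of_not fun hn => h ⟨hn, hn₁, hn₂⟩]
        simp

/-- A cocycle that spans the cocycles of odd degree in a given weight. -/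
def oddCocycle (k : Type*) [Field k] (a b q : ℕ) (N : ℤ) : Cochain k a b (2 * q + 1) :=
  .ofValues fun g => match g.1.1 with
    | .e₁ => (b : k) • monom k a b (N - m₁ a b)
    | .e₂ => (a : k) • monom k a b (N - m₂ a b)
    | _ => 0

theorem oddCocycle_value_genE₁ (q : ℕ) (N : ℤ) :
    (oddCocycle k a b q N).value (genE₁ q rfl) = (b : k) • monom k a b (N - m₁ a b) :=
  Cochain.value_ofValues _ _

theorem oddCocycle_value_genE₂ (q : ℕ) (N : ℤ) :
    (oddCocycle k a b q N).value (genE₂ q rfl) = (a : k) • monom k a b (N - m₂ a b) :=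
  Cochain.value_ofValues _ _

open Classical in
theorem finrank_HHPiece_odd_of (ha : 0 < a) (hb : 0 < b) (hka : (a : k) ≠ 0) (hkb : (b : k) ≠ 0)
    (q : ℕ) {n N : ℤ} (hN : N = n + a * b * (q + 1)) {p : Prop}
    [Decidable p]
    (hp : InSemigroup a b (N - m₁ a b) → InSemigroup a b (N - m₂ a b) →
      (oddCocycle k a b q N ∈ coboundaries k a b (2 * q + 1) ↔ ¬ p)) :
    Module.Finite k (HHPiece k a b (2 * q + 1) n) ∧
      Module.finrank k (HHPiece k a b (2 * q + 1) n) =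
        if (InSemigroup a b (N - m₁ a b) ∧ InSemigroup a b (N - m₂ a b)) ∧ p
        then 1 else 0 := by
  have h₁ := InSemigroup.m₁_mem (b := b) ha
  have h₂ := InSemigroup.m₂_mem (a := a) hb
  have hw₁ : n + Gen.weight a b (.e₁, q) = N - m₁ a b := by
    rw [hN, Gen.weight, m₁]; ring
  have hw₂ : n + Gen.weight a b (.e₂, q) = N - m₂ a b := by
    rw [hN, Gen.weight, m₂]; ring
  have hcocycle {f : Cochain k a b (2 * q + 1)} (hf : f ∈ cocycles k a b (2 * q + 1)) :
      (a : k) • (monom k a b (m₁ a b) * f.value (genE₁ q rfl)) =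
        (b : k) • (monom k a b (m₂ a b) * f.value (genE₂ q rfl)) := by
    have := coboundary_value_genOne ha hb rfl f
    rw [LinearMap.mem_ker.mp hf, Cochain.value_zero] at this
    exact (sub_eq_zero.mp this.symm)
  by_cases hn : InSemigroup a b (N - m₁ a b) ∧ InSemigroup a b (N - m₂ a b)
  · obtain ⟨hn₁, hn₂⟩ := hn
    refine finrank_HHPiece_of_span (c := oddCocycle k a b q N) ?_ (GenDeg.forall_odd rfl ?_ ?_)
      ?_ (by rw [hp hn₁ hn₂]; tauto)
    · refine LinearMap.mem_ker.mpr (Cochain.ext (GenDeg.forall_even (q := q) (by omega) ?_ ?_))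
      · rw [coboundary_value_genOne ha hb rfl, oddCocycle_value_genE₁, oddCocycle_value_genE₂,
          mul_smul_comm, mul_smul_comm, monom_mul_sub h₁ hn₁, monom_mul_sub h₂ hn₂, smul_comm,
          sub_self, Cochain.value_zero]
      · rw [coboundary_value_genE₁₂ rfl, Cochain.value_zero]
    · rw [oddCocycle_value_genE₁]
      exact smul_monom_mem _ hw₁
    · rw [oddCocycle_value_genE₂]
      exact smul_monom_mem _ hw₂
    · intro f hf hfZ
      obtain ⟨r, hr⟩ := exists_value_eq hf (genE₁ q rfl) hw₁
      obtain ⟨r', hr'⟩ := exists_value_eq hf (genE₂ q rfl) hw₂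
      have h := hcocycle hfZ
      rw [hr, hr', mul_smul_comm, mul_smul_comm, monom_mul_sub h₁ hn₁, monom_mul_sub h₂ hn₂,
        smul_smul, smul_smul] at h
      have h := smul_left_injective k (monom_ne_zero (by simpa using hn₁.add h₁)) h
      refine ⟨r / b, Cochain.ext (GenDeg.forall_odd rfl ?_ ?_)⟩
      · rw [hr, Cochain.value_smul, oddCocycle_value_genE₁, smul_smul, div_mul_cancel₀ _ hkb]
      · rw [hr', Cochain.value_smul, oddCocycle_value_genE₂, smul_smul]
        congr 1
        field_simp
        linear_combination -h
  · refine finrank_HHPiece_of_span (c := 0) (Submodule.zero_mem _) (Submodule.zero_mem _) ?_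
      (by simp only [Submodule.zero_mem]; tauto)
    intro f hf hfZ
    obtain ⟨r, hr⟩ := exists_value_eq hf (genE₁ q rfl) hw₁
    obtain ⟨r', hr'⟩ := exists_value_eq hf (genE₂ q rfl) hw₂
    have h := hcocycle hfZ
    have h0 : f.value (genE₁ q rfl) = 0 ∧ f.value (genE₂ q rfl) = 0 := by
      by_cases hn₁ : InSemigroup a b (N - m₁ a b)
      · have h0 : f.value (genE₂ q rfl) = 0 := by
          rw [hr', monom_of_not fun hn₂ => hn ⟨hn₁, hn₂⟩, smul_zero]
        refine ⟨?_, h0⟩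
        rw [h0, mul_zero, smul_zero, smul_eq_zero_iff_right hka] at h
        exact (mul_eq_zero.mp h).resolve_left (monom_ne_zero h₁)
      · have h0 : f.value (genE₁ q rfl) = 0 := by rw [hr, monom_of_not hn₁, smul_zero]
        refine ⟨h0, ?_⟩
        rw [h0, mul_zero, smul_zero, eq_comm, smul_eq_zero_iff_right hkb] at h
        exact (mul_eq_zero.mp h).resolve_left (monom_ne_zero h₂)
    exact ⟨0, Cochain.ext (GenDeg.forall_odd rfl (by rw [h0.1, smul_zero, Cochain.value_zero])
      (by rw [h0.2, smul_zero, Cochain.value_zero]))⟩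

open Classical in
theorem finrank_HHPiece_one (ha : 0 < a) (hb : 0 < b) (hka : (a : k) ≠ 0) (hkb : (b : k) ≠ 0)
    {n N : ℤ} (hN : N = n + a * b) :
    Module.Finite k (HHPiece k a b 1 n) ∧
      Module.finrank k (HHPiece k a b 1 n) =
        if InSemigroup a b (N - m₁ a b) ∧ InSemigroup a b (N - m₂ a b) then 1 else 0 := by
  have := finrank_HHPiece_odd_of ha hb hka hkb 0 (n := n) (N := N) (p := True) (by simp [hN]) ?_
  · simpa only [and_true] using this
  intro hn₁ _
  simp only [not_true, iff_false]
  rintro ⟨f, hf⟩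
  rw [coboundary_zero] at hf
  have h := oddCocycle_value_genE₁ (k := k) (a := a) (b := b) 0 N
  rw [← hf, Cochain.value_zero, eq_comm, smul_eq_zero_iff_right hkb] at h
  exact monom_ne_zero hn₁ h

open Classical in
theorem finrank_HHPiece_odd (ha : 0 < a) (hb : 0 < b) (hka : (a : k) ≠ 0) (hkb : (b : k) ≠ 0)
    (q : ℕ) {n N : ℤ} (hN : N = n + a * b * (q + 2)) :
    Module.Finite k (HHPiece k a b (2 * q + 3) n) ∧
      Module.finrank k (HHPiece k a b (2 * q + 3) n) =
        if (InSemigroup a b (N - m₁ a b) ∧ InSemigroup a b (N - m₂ a b)) ∧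
          ¬ InSemigroup a b (N - m₁ a b - m₂ a b) then 1 else 0 := by
  have h₁ := InSemigroup.m₁_mem (b := b) ha
  have h₂ := InSemigroup.m₂_mem (a := a) hb
  refine finrank_HHPiece_odd_of ha hb hka hkb (q + 1) (n := n) (N := N) (by rw [hN]; push_cast; ring) ?_
  intro hn₁ hn₂
  rw [not_not]
  constructor
  · rintro ⟨f, hf⟩
    have h := coboundary_value_genE₁ hb (m := 2 * (q + 1)) rfl f
    rw [hf, oddCocycle_value_genE₁] at h
    exact inSemigroup_of_monom_eq_monom_mul h₂ hn₁ (smul_right_injective _ hkb h)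
  · intro hn
    refine ⟨.ofValues fun g => match g.1.1 with
      | .e₁₂ => monom k a b (N - m₁ a b - m₂ a b)
      | _ => 0, Cochain.ext (GenDeg.forall_odd rfl ?_ ?_)⟩
    · rw [coboundary_value_genE₁ hb (m := 2 * (q + 1)) rfl, oddCocycle_value_genE₁, Cochain.value_ofValues,
        monom_mul_sub h₂ hn]
    · rw [coboundary_value_genE₂ ha (m := 2 * (q + 1)) rfl, oddCocycle_value_genE₂, Cochain.value_ofValues]
      rw [sub_right_comm] at hn ⊢
      rw [monom_mul_sub h₁ hn]

end

end

/-! ## The Hilbert series -/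

noncomputable section

section

open Classical in
/-- The indicator function of the semigroup. -/
def indicator (a b : ℕ) (n : ℤ) : ℚ := if InSemigroup a b n then 1 else 0

/-- The Hilbert series `∑ y^n` of the semigroup. -/
def semigroupSeries (a b : ℕ) : LaurentSeries ℚ :=
  HahnSeries.ofSuppBddBelow (indicator a b) ⟨0, fun n hn => by
    by_contra h
    exact hn (if_neg fun h' => h h'.nonneg)⟩

theorem semigroupSeries_coeff (a b : ℕ) (n : ℤ) :
    (semigroupSeries a b).coeff n = indicator a b n := rfl

/-- The monomial `y^n` as a Laurent series. -/
abbrev yL (n : ℤ) : LaurentSeries ℚ := HahnSeries.single n 1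

theorem yL_mul (m n : ℤ) : yL m * yL n = yL (m + n) := by
  simp [yL]

theorem yL_mul_coeff (m n : ℤ) (f : LaurentSeries ℚ) : (yL m * f).coeff n = f.coeff (n - m) := by
  rw [HahnSeries.coeff_single_mul, one_mul]

theorem yL_coeff (m n : ℤ) : (yL m).coeff n = if n = m then 1 else 0 := by
  split_ifs with h
  · rw [h, HahnSeries.coeff_single_same]
  · exact HahnSeries.coeff_single_of_ne h

variable {a b : ℕ}

theorem semigroupSeries_mul (ha : 0 < a) (hb : 0 < b) (hab : Nat.Coprime a b) :
    semigroupSeries a b * (1 - yL a) = ∑ i ∈ Finset.range a, yL (b : ℤ) ^ i := by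
  have hpow (i : ℕ) : yL (b : ℤ) ^ i = yL (b * i) := by
    simp [yL, HahnSeries.single_pow, mul_comm]
  ext n
  rw [mul_sub, mul_one, mul_comm, HahnSeries.coeff_sub, yL_mul_coeff, HahnSeries.coeff_sum]
  simp only [hpow, yL_coeff, semigroupSeries_coeff, indicator]
  have key := InSemigroup.and_not_sub_iff (n := n) ha hab
  by_cases h : ∃ j : ℕ, j < a ∧ n = b * j
  · obtain ⟨h₁, h₂⟩ := key.mpr h
    obtain ⟨j, hj, rfl⟩ := h
    rw [Finset.sum_eq_single j]
    · simp [h₁, h₂]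
    · intro i _ hij
      rw [if_neg]
      intro h
      have := mul_left_cancel₀ (by exact_mod_cast hb.ne') h
      exact hij (by exact_mod_cast this.symm)
    · intro h
      simp [hj] at h
  · rw [Finset.sum_eq_zero]
    · have h₁ : InSemigroup a b n ↔ InSemigroup a b (n - a) :=
        ⟨fun h' => by_contra fun h'' => h (key.mp ⟨h', h''⟩), fun h' => by
          simpa using h'.add InSemigroup.left_mem⟩
      classical rw [if_congr h₁ rfl rfl, sub_self]
    · intro i hi
      rw [if_neg fun hn => h ⟨i, by simpa using hi, hn⟩]

theorem H₁_eq (ha : 0 < a) (hb : 0 < b) (hab : Nat.Coprime a b) :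
    H₁ a b = PowerSeries.C (semigroupSeries a b) := by
  symm
  rw [H₁, PowerSeries.eq_mul_inv_iff_mul_eq (denominators_ne_zero a b ha hb).2]
  have h : semigroupSeries a b * ((1 - yL a) * (1 - yL b)) = 1 - yL (a * b) := by
    rw [← mul_assoc, semigroupSeries_mul ha hb hab, geom_sum_mul_neg]
    simp [yL, HahnSeries.single_pow]
  simp only [y, ← map_one (PowerSeries.C (R := LaurentSeries ℚ)), ← map_sub, ← map_mul]
  rw [h]

theorem Q_mul (a b : ℕ) (ha : 0 < a) (hb : 0 < b) :
    Q a b = x ^ 2 * (y (-(a * b)) * (1 + Q a b)) := by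
  have h : Q a b * (1 - x ^ 2 * y (-(a * b))) = x ^ 2 * y (-(a * b)) := by
    rw [← PowerSeries.eq_mul_inv_iff_mul_eq (denominators_ne_zero a b ha hb).1, Q]
  linear_combination h

theorem coeff_Q (ha : 0 < a) (hb : 0 < b) (q : ℕ) :
    PowerSeries.coeff (2 * q) (Q a b) = (if q = 0 then 0 else yL (-(a * b) * q)) ∧
      PowerSeries.coeff (2 * q + 1) (Q a b) = 0 := by
  induction q with
  | zero =>
    rw [Q_mul a b ha hb]
    simp only [x, PowerSeries.coeff_X_pow_mul']
    simp
  | succ q ih =>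
    rw [Q_mul a b ha hb, x, y]
    constructor
    · rw [show 2 * (q + 1) = 2 * q + 2 by ring, PowerSeries.coeff_X_pow_mul,
        PowerSeries.coeff_C_mul, map_add, ih.1, if_neg (Nat.succ_ne_zero q)]
      obtain _ | q := q
      · simp
      · rw [if_neg (Nat.succ_ne_zero q), PowerSeries.coeff_one, if_neg (by omega), zero_add,
          yL_mul]
        congr 1
        push_cast
        ring
    · rw [show 2 * (q + 1) + 1 = 2 * q + 1 + 2 by ring, PowerSeries.coeff_X_pow_mul,
        PowerSeries.coeff_C_mul, map_add, ih.2, PowerSeries.coeff_one, if_neg (by omega)]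
      simp

variable (a b) in
/-- The coefficients in even degrees, up to a shift. -/
def evenSeries : LaurentSeries ℚ :=
  semigroupSeries a b - (yL (m₁ a b) * semigroupSeries a b + yL (m₂ a b) * semigroupSeries a b) +
    (yL (m₁ a b + m₂ a b) + yL (a * b) * semigroupSeries a b)

variable (a b) in
/-- The coefficients in odd degrees at least three, up to a shift. -/
def oddSeries : LaurentSeries ℚ :=
  semigroupSeries a b - yL (a * b - a - b) * (semigroupSeries a b - 1)

theorem H_eq (ha : 0 < a) (hb : 0 < b) (hab : Nat.Coprime a b) :
    H₁ a b + H₂ a b + H₃ a b =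
      PowerSeries.C (semigroupSeries a b) + Q a b * PowerSeries.C (evenSeries a b) +
        PowerSeries.X * (PowerSeries.C (yL (a * b - a - b) + semigroupSeries a b) +
          Q a b * PowerSeries.C (oddSeries a b)) := by
  rw [H₂, H₂₁, H₂₂, H₂₃, H₂₄, H₃, H₃₁, H₃₂, H₃₃, H₁_eq ha hb hab, evenSeries, oddSeries]
  simp only [y, x, map_add, map_sub, map_mul, map_one]
  ring

theorem coeff_zero_H (ha : 0 < a) (hb : 0 < b) (hab : Nat.Coprime a b) :
    PowerSeries.coeff 0 (H₁ a b + H₂ a b + H₃ a b) = semigroupSeries a b := by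
  have := (coeff_Q ha hb 0).1
  rw [H_eq ha hb hab]
  simp only [map_add, PowerSeries.coeff_mul_C, this, PowerSeries.coeff_zero_X_mul,
    PowerSeries.coeff_zero_C]
  simp

theorem coeff_one_H (ha : 0 < a) (hb : 0 < b) (hab : Nat.Coprime a b) :
    PowerSeries.coeff 1 (H₁ a b + H₂ a b + H₃ a b) =
      yL (a * b - a - b) + semigroupSeries a b := by
  have h₀ := (coeff_Q ha hb 0).1
  have h₁ := (coeff_Q ha hb 0).2
  rw [H_eq ha hb hab, ← zero_add 1, map_add, map_add, PowerSeries.coeff_succ_X_mul]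
  simp only [mul_zero, zero_add, if_true] at h₀ h₁
  rw [map_add, PowerSeries.coeff_mul_C, PowerSeries.coeff_mul_C, zero_add, h₁, h₀]
  simp

theorem coeff_even_H (ha : 0 < a) (hb : 0 < b) (hab : Nat.Coprime a b) (q : ℕ) :
    PowerSeries.coeff (2 * q + 2) (H₁ a b + H₂ a b + H₃ a b) =
      yL (-(a * b) * (q + 1)) * evenSeries a b := by
  have h₀ := (coeff_Q ha hb (q + 1)).1
  have h₁ := (coeff_Q ha hb q).2
  rw [H_eq ha hb hab, map_add, map_add, PowerSeries.coeff_succ_X_mul, map_add,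
    PowerSeries.coeff_mul_C, PowerSeries.coeff_mul_C, h₁]
  rw [mul_add, mul_one, if_neg (Nat.succ_ne_zero q)] at h₀
  rw [h₀]
  simp

theorem coeff_odd_H (ha : 0 < a) (hb : 0 < b) (hab : Nat.Coprime a b) (q : ℕ) :
    PowerSeries.coeff (2 * q + 3) (H₁ a b + H₂ a b + H₃ a b) =
      yL (-(a * b) * (q + 1)) * oddSeries a b := by
  have h₀ := (coeff_Q ha hb (q + 1)).1
  have h₁ := (coeff_Q ha hb (q + 1)).2
  rw [H_eq ha hb hab, map_add, map_add, PowerSeries.coeff_succ_X_mul, map_add,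
    PowerSeries.coeff_mul_C, PowerSeries.coeff_mul_C]
  rw [mul_add, mul_one, if_neg (Nat.succ_ne_zero q)] at h₀
  rw [mul_add, mul_one, add_assoc] at h₁
  rw [h₀, h₁]
  simp

open Classical in
theorem evenSeries_coeff (ha : 0 < a) (hb : 0 < b) (hab : Nat.Coprime a b) (N : ℤ) :
    (evenSeries a b).coeff N =
      if InSemigroup a b N ∧ ¬ InSemigroup a b (N - m₁ a b) ∧ ¬ InSemigroup a b (N - m₂ a b)
      then 1 else 0 := by
  have h := InSemigroup.inter_iff (n := N) ha hb hab
  have h₁ (h : InSemigroup a b (N - m₁ a b)) : InSemigroup a b N := by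
    simpa using h.add (InSemigroup.m₁_mem ha)
  have h₂ (h : InSemigroup a b (N - m₂ a b)) : InSemigroup a b N := by
    simpa using h.add (InSemigroup.m₂_mem hb)
  have h₃ : N = m₁ a b + m₂ a b → ¬ InSemigroup a b (N - a * b) := by
    rintro rfl
    convert InSemigroup.not_frobenius ha hab using 2
    rw [m₁, m₂]
    ring
  simp only [evenSeries, HahnSeries.coeff_add, HahnSeries.coeff_sub, yL_mul_coeff, yL_coeff,
    semigroupSeries_coeff, indicator]
  generalize InSemigroup a b (N - m₁ a b) = P₁ at *
  generalize InSemigroup a b (N - m₂ a b) = P₂ at *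
  generalize InSemigroup a b (N - a * b) = R at *
  generalize InSemigroup a b N = P at *
  rw [show (if N = m₁ a b + m₂ a b then (1 : ℚ) else 0) =
    @ite _ (N = m₁ a b + m₂ a b) (Classical.propDecidable _) 1 0 by congr]
  generalize (N = m₁ a b + m₂ a b) = E at *
  by_cases P <;> by_cases P₁ <;> by_cases P₂ <;> by_cases E <;> by_cases R <;> simp_all

theorem sub_m₁_sub_m₂ (N : ℤ) :
    N - m₁ a b - m₂ a b = N - a * b - (a * b - a - b) := by
  rw [m₁, m₂]
  ring

open Classical in
theorem oddSeries_coeff (ha : 0 < a) (hb : 0 < b) (hab : Nat.Coprime a b) (N : ℤ) :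
    (oddSeries a b).coeff (N - a * b) =
      if (InSemigroup a b (N - m₁ a b) ∧ InSemigroup a b (N - m₂ a b)) ∧
          ¬ InSemigroup a b (N - m₁ a b - m₂ a b) then 1 else 0 := by
  have h := InSemigroup.inter_iff (n := N) ha hb hab
  have hz : N - a * b - (a * b - a - b) = 0 ↔ N = m₁ a b + m₂ a b := by
    rw [← sub_m₁_sub_m₂, sub_sub, sub_eq_zero]
  have h₁ (h : InSemigroup a b (N - m₁ a b - m₂ a b)) :
      InSemigroup a b (N - m₁ a b) ∧ InSemigroup a b (N - m₂ a b) := by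
    refine ⟨by simpa using h.add (InSemigroup.m₂_mem hb), ?_⟩
    rw [sub_right_comm] at h
    simpa using h.add (InSemigroup.m₁_mem ha)
  have h₂ : N = m₁ a b + m₂ a b → InSemigroup a b (N - m₁ a b - m₂ a b) := by
    rintro rfl
    simpa using InSemigroup.zero a b
  have h₃ : N = m₁ a b + m₂ a b → ¬ InSemigroup a b (N - a * b) := by
    rintro rfl
    convert InSemigroup.not_frobenius ha hab using 2
    rw [m₁, m₂]
    ring
  simp only [oddSeries, HahnSeries.coeff_sub, yL_mul_coeff, HahnSeries.coeff_one, hz,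
    semigroupSeries_coeff, indicator]
  simp only [h]
  rw [h] at h₁
  rw [sub_m₁_sub_m₂] at h₁ h₂ ⊢
  generalize InSemigroup a b (N - a * b - (a * b - a - b)) = P at *
  generalize InSemigroup a b (N - a * b) = R at *
  by_cases c₁ : N = m₁ a b + m₂ a b <;> by_cases P <;> by_cases R <;> simp_all

open Classical in
theorem oneSeries_coeff (ha : 0 < a) (hb : 0 < b) (hab : Nat.Coprime a b) (n : ℤ) :
    (yL (a * b - a - b) + semigroupSeries a b).coeff n =
      if InSemigroup a b (n + a * b - m₁ a b) ∧ InSemigroup a b (n + a * b - m₂ a b)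
      then 1 else 0 := by
  have hF : n = a * b - a - b ↔ n + a * b = m₁ a b + m₂ a b := by
    rw [m₁, m₂]
    constructor <;> intro h <;> linear_combination h
  have h₁ : n = a * b - a - b → ¬ InSemigroup a b n := by
    rintro rfl
    exact InSemigroup.not_frobenius ha hab
  simp only [InSemigroup.inter_iff ha hb hab, ← hF, add_sub_cancel_right, HahnSeries.coeff_add,
    yL_coeff, semigroupSeries_coeff, indicator]
  by_cases c₁ : n = a * b - a - b
  · simp [c₁]
    exact InSemigroup.not_frobenius ha hab
  · simp [c₁]

theorem isHilbertSeries (k : Type*) [Field k] (ha : 0 < a) (hb : 0 < b) (hab : Nat.Coprime a b)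
    (hka : (a : k) ≠ 0) (hkb : (b : k) ≠ 0) :
    IsHilbertSeries k a b (H₁ a b + H₂ a b + H₃ a b) := by
  intro m n
  obtain ⟨q, rfl | rfl⟩ := m.even_or_odd'
  · obtain _ | q := q
    · obtain ⟨hfin, h⟩ := finrank_HHPiece_zero (k := k) (a := a) (b := b) n
      refine ⟨hfin, ?_⟩
      rw [mul_zero, h, coeff_zero_H ha hb hab, semigroupSeries_coeff, indicator]
      push_cast
      rfl
    · obtain ⟨hfin, h⟩ := finrank_HHPiece_even ha hb hka hkb q (n := n) rfl
      refine ⟨hfin, ?_⟩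
      rw [show 2 * (q + 1) = 2 * q + 2 by ring, h, coeff_even_H ha hb hab, yL_mul_coeff,
        neg_mul, sub_neg_eq_add, evenSeries_coeff ha hb hab]
      push_cast
      rfl
  · obtain _ | q := q
    · obtain ⟨hfin, h⟩ := finrank_HHPiece_one ha hb hka hkb (n := n) rfl
      refine ⟨hfin, ?_⟩
      rw [mul_zero, zero_add, h, coeff_one_H ha hb hab, oneSeries_coeff ha hb hab]
      push_cast
      rfl
    · obtain ⟨hfin, h⟩ := finrank_HHPiece_odd ha hb hka hkb q (n := n) rfl
      refine ⟨hfin, ?_⟩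
      rw [show 2 * (q + 1) + 1 = 2 * q + 3 by ring, h, coeff_odd_H ha hb hab, yL_mul_coeff,
        show n - -(a * b) * ((q : ℤ) + 1) = n + a * b * (q + 2) - a * b by ring,
        oddSeries_coeff ha hb hab]
      push_cast
      rfl

end

end

end SemigroupHH

theorem mainTheorem5 (k : Type*) [Field k] (a b : ℕ) (ha : 0 < a) (hb : 0 < b)
    (hab : Nat.Coprime a b) (hka : ¬ ringChar k ∣ a) (hkb : ¬ ringChar k ∣ b) :
    -- `F` is a resolution of `A` by free modules over the enveloping algebra
    (Function.Surjective (SemigroupHH.augmentation k a b) ∧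
      Function.Exact (SemigroupHH.d k a b 0) (SemigroupHH.augmentation k a b) ∧
      ∀ m : ℕ, Function.Exact (SemigroupHH.d k a b (m + 1)) (SemigroupHH.d k a b m)) ∧
    -- the components `H_{m,n}` form a grading of `HH^m(A)`
    (∀ m : ℕ, DirectSum.IsInternal (fun n : ℤ => SemigroupHH.HHPiece k a b m n)) ∧
    -- the Hilbert series
    SemigroupHH.IsHilbertSeries k a b
      (SemigroupHH.H₁ a b + SemigroupHH.H₂ a b + SemigroupHH.H₃ a b) := by
  rw [← ringChar.spec] at hka hkb
  exact ⟨⟨SemigroupHH.augmentation_surjective, SemigroupHH.exact_augmentation,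
    SemigroupHH.exact_d ha hab⟩, SemigroupHH.isInternal_HHPiece ha hb,
    SemigroupHH.isHilbertSeries k ha hb hab hka hkb⟩
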